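/- Let $d \ge 2$, $n_1, \ldots, n_d \ge 1$ and $r_1, \ldots, r_{d-1} \ge 1$ be integers, and put $N = n_1 \cdots n_d$ and $n = \max(n_1, \ldots, n_d)$. Equip $\mathbb{R}^{n_1 \times \cdots \times n_d}$ with the Frobenius inner product. For a tensor $X$ let $X^{\langle k \rangle} \in \mathbb{R}^{(n_1 \cdots n_k) \times (n_{k+1} \cdots n_d)}$ be its $k$-th unfolding, and let $\mathcal{M}_r$ be the manifold of tensors of TT-rank $r = (r_1, \ldots, r_{d-1})$, i.e. of all $X$ with $\operatorname{rank} X^{\langle k \rangle} = r_k$ for $k = 1, \ldots, d-1$. For $A \in \mathcal{M}_r$ let $\mathcal{P}_A$ be the orthogonal projection of $\mathbb{R}^{n_1 \times \cdots \times n_d}$ onto the tangent space $T_A \mathcal{M}_r$. The coherence of a $p$-dimensional subspace $T \subseteq \mathbb{R}^q$ ($p \ge 1$) is $\mu(T) = \frac{q}{p} \max_{1 \le i \le q} \| P_T e_i \|_2^2$, where $P_T$ is the orthogonal projection onto $T$. The interface coherence $\mu_I(A)$ is the largest of the coherences of the column and row spaces of $A^{\langle 1 \rangle}, \ldots, A^{\langle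 d-1 \rangle}$ (these are the column spaces of the left and right interface matrices $A_{\le k}$ and $A_{\ge k+1}$ of any minimal tensor-train representation of $A$). Let $A \in \mathcal{M}_r$ have $\mu_I(A) \le \mu_0$, and let $\Omega = (\omega_1, \ldots, \omega_m)$ be a sample of $m$ independent indices, each uniformly distributed on $[n_1] \times \cdots \times [n_d]$ (sampling with replacement). Put $\rho = m / N$ and $\mathcal{R}_\Omega X = \sum_{j=1}^m X(\omega_j) E_{\omega_j}$, where $E_\omega$ is the canonical basis tensor at the index $\omega$. Let $$C_0 = \frac{\mu_0}{n_1 \cdots n_d} \Big( n_1 r_1 + \mu_0 \sum_{k=2}^{d-1} r_{k-1} n_k r_k + r_{d-1} n_d \Big).$$ Then for all $0 < \varepsilon < 1$ and $\beta > 1$ such that $$\rho \ge \frac{8}{3} \, \frac{C_0}{\varepsilon^2} \, d \beta \log n,$$ the restricted isometry property on the tangent space $$\big\| \mathcal{P}_A - \rho^{-1} \mathcal{P}_A \mathcal{R}_\Omega \mathcal{P}_A \big\| < \varepsilon$$ (operator norm induced by the Frobenius norm) holds with probability at least $1 - 2 n^{d(1-\beta)}$. -/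

import Mathlib

open scoped ContDiff

noncomputable section

namespace TensorTrain

/-- Multi-indices `(i_k)_{k ∈ s}` with `i_k ∈ [n_k]`. The modes are numbered `1, …, d`, so a full
multi-index is an element of `MultiIndex n (Finset.Icc 1 d)`. -/
abbrev MultiIndex (n : ℕ → ℕ) (s : Finset ℕ) : Type := ∀ k : s, Fin (n k)

/-- Tensors in `ℝ^{n_1 × ⋯ × n_d}`, with the Frobenius inner product and norm. -/
abbrev Tensor (d : ℕ) (n : ℕ → ℕ) : Type := EuclideanSpace ℝ (MultiIndex n (Finset.Icc 1 d))

/-- Concatenation `(i_1, …, i_k), (i_{k+1}, …, i_d) ↦ (i_1, …, i_d)`. -/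
def concat {n : ℕ → ℕ} {d : ℕ} (k : ℕ) (i : MultiIndex n (Finset.Icc 1 k))
    (j : MultiIndex n (Finset.Icc (k + 1) d)) : MultiIndex n (Finset.Icc 1 d) := fun l =>
  if h : (l : ℕ) ≤ k then
    i ⟨l, Finset.mem_Icc.2 ⟨(Finset.mem_Icc.1 l.2).1, h⟩⟩
  else
    j ⟨l, Finset.mem_Icc.2 ⟨Nat.succ_le_of_lt (not_le.1 h), (Finset.mem_Icc.1 l.2).2⟩⟩

/-- The `k`-th unfolding, a matrix of size `(n_1 ⋯ n_k) × (n_{k+1} ⋯ n_d)`. -/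
def unfolding {d : ℕ} {n : ℕ → ℕ} (X : Tensor d n) (k : ℕ) :
    Matrix (MultiIndex n (Finset.Icc 1 k)) (MultiIndex n (Finset.Icc (k + 1) d)) ℝ :=
  Matrix.of fun i j => X (concat k i j)

/-- The set `M_r` of tensors of TT-rank `r = (r_1, …, r_{d-1})`; only the values `r k` with
`1 ≤ k ≤ d - 1` matter. -/
def fixedRank (d : ℕ) (n r : ℕ → ℕ) : Set (Tensor d n) :=
  {X | ∀ k ∈ Finset.Icc 1 (d - 1), (unfolding X k).rank = r k}

/-- The tangent space at `A` of `M_r`: the velocities at `A` of the smooth curves in `M_r`. As `M_r`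
is a smooth embedded submanifold, these velocities already form a linear subspace when `A ∈ M_r`; the
span only records it as a `Submodule`. -/
def tangentSpace {d : ℕ} {n : ℕ → ℕ} (r : ℕ → ℕ) (A : Tensor d n) : Submodule ℝ (Tensor d n) :=
  Submodule.span ℝ {Y | ∃ γ : ℝ → Tensor d n, ContDiff ℝ ∞ γ ∧ (∀ t, γ t ∈ fixedRank d n r) ∧
    γ 0 = A ∧ HasDerivAt γ Y 0}

/-- The orthogonal projection onto the tangent space of `M_r` at `A`, as an operator on the whole
space of tensors. -/
def tangentProj {d : ℕ} {n : ℕ → ℕ} (r : ℕ → ℕ) (A : Tensor d n) : Tensor d n →L[ℝ] Tensor d n :=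
  (tangentSpace r A).starProjection

/-- The column space of a matrix. -/
def columnSpace {ι κ : Type*} [Fintype κ] [DecidableEq κ]
    (M : Matrix ι κ ℝ) : Submodule ℝ (EuclideanSpace ℝ ι) :=
  LinearMap.range (Matrix.toEuclideanLin M)

/-- The coherence `μ(T) = (n / dim T) * max_i ‖P_T e_i‖²` of a subspace `T` of `ℝ^n`. -/
def coherence {ι : Type*} [Fintype ι] [DecidableEq ι] (T : Submodule ℝ (EuclideanSpace ℝ ι)) : ℝ :=
  (Fintype.card ι : ℝ) / (Module.finrank ℝ T : ℝ) *
    ⨆ i : ι, ‖T.starProjection (EuclideanSpace.single i 1)‖ ^ 2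

/-- If `M = L Rᵀ` is a factorization with inner dimension `rank M`, the columns of `L` span the
column space of `M`. Applied to the unfoldings `A^{⟨k⟩} = A_{≤k} A_{≥k+1}ᵀ` and their transposes,
this says that `A_{≤k}` and `A_{≥k+1}`, built from any TT-representation of minimal ranks, span the
column and the row space of `A^{⟨k⟩}`. -/
theorem columnSpace_of_rank_factorization {ι κ ν : Type*} [Fintype ι] [DecidableEq ι] [Fintype κ]
    [DecidableEq κ] [Fintype ν] [DecidableEq ν] (M : Matrix ι κ ℝ) (L : Matrix ι ν ℝ)
    (R : Matrix κ ν ℝ) (h : M = L * R.transpose) (hrank : M.rank = Fintype.card ν) :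
    columnSpace L = columnSpace M := by
  have hM : Module.finrank ℝ (columnSpace M) = M.rank := by
    rw [columnSpace, Matrix.rank_eq_finrank_range_toLin M (EuclideanSpace.basisFun ι ℝ).toBasis
      (EuclideanSpace.basisFun κ ℝ).toBasis, Matrix.toEuclideanLin_eq_toLin_orthonormal]
  have hle : columnSpace M ≤ columnSpace L := by
    rintro _ ⟨x, rfl⟩
    refine ⟨Matrix.toEuclideanLin R.transpose x, ?_⟩
    rw [h]
    apply (WithLp.equiv 2 (ι → ℝ)).injective
    simp [Matrix.toEuclideanLin, Matrix.toLpLin_apply, Matrix.mulVec_mulVec]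
  refine (Submodule.eq_of_le_of_finrank_le hle ?_).symm
  rw [hM, hrank]
  refine (LinearMap.finrank_range_le (Matrix.toEuclideanLin L)).trans ?_
  simp

/-- The interface coherence `μ_I(A)`: the largest coherence of the column spaces of the left and right
interface matrices `A_{≤k}`, `A_{≥k+1}`, `1 ≤ k ≤ d - 1`, that is, of the column and row spaces of
the unfoldings of `A`. -/
def interfaceCoherence {d : ℕ} {n : ℕ → ℕ} (A : Tensor d n) : ℝ :=
  ⨆ k : Finset.Icc 1 (d - 1),
    max (coherence (columnSpace (unfolding A k)))
      (coherence (columnSpace (unfolding A k).transpose))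

/-- The sampling operator `X ↦ ∑_{ω ∈ Ω} X(ω) E_ω` of a finite sequence `Ω` of multi-indices,
counted with repetitions. -/
def samplingOp {d : ℕ} {n : ℕ → ℕ} {m : ℕ} (Ω : Fin m → MultiIndex n (Finset.Icc 1 d)) :
    Tensor d n →L[ℝ] Tensor d n :=
  ∑ j : Fin m, (EuclideanSpace.proj (Ω j) : Tensor d n →L[ℝ] ℝ).smulRight
    (EuclideanSpace.single (Ω j) (1 : ℝ))

/-- The number of entries `n_1 ⋯ n_d`. -/
def numEntries (d : ℕ) (n : ℕ → ℕ) : ℝ := ∏ k ∈ Finset.Icc 1 d, (n k : ℝ)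

/-- The sampling density `ρ = |Ω| / (n_1 ⋯ n_d)` of a sample of size `m`. -/
def density (d : ℕ) (n : ℕ → ℕ) (m : ℕ) : ℝ := (m : ℝ) / numEntries d n

/-- `n = max (n_1, …, n_d)`. -/
def maxSize (d : ℕ) (n : ℕ → ℕ) : ℕ := (Finset.Icc 1 d).sup n

/-- `C_0 = μ_0 (n_1 r_1 + μ_0 ∑_{k=2}^{d-1} r_{k-1} n_k r_k + r_{d-1} n_d) / (n_1 ⋯ n_d)`. -/
def coherenceConst (d : ℕ) (n r : ℕ → ℕ) (μ₀ : ℝ) : ℝ :=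
  μ₀ / numEntries d n *
    (n 1 * r 1 + μ₀ * ∑ k ∈ Finset.Icc 2 (d - 1), (r (k - 1) * n k * r k : ℝ) + r (d - 1) * n d)

end TensorTrain

end

/-! ### Trace inequalities for powers of products of real matrices. -/

section TraceInequalities

variable {ι : Type*} [Fintype ι]

/-! The proof has a deterministic half and a probabilistic half, and the only link between them is a
bound on entries: every `x` in the tangent space `T` satisfies `x l ^ 2 ≤ C₀ * ‖x‖ ^ 2`
(`sq_apply_le_of_mem_tangentSpace`).

Deterministic half. Constancy of rank along curves forces a tangent tensor to send, in each
unfolding, the complement of the row space of `A` into the column space of `A`; no other property of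
`T` is needed. Let `V_k` be the tensors whose `k`-th unfolding has its columns in the column space
of that of `A`, with `V_0` everything and `V_d = 0`. These spaces decrease, so `x` is the orthogonal
sum of the pieces `z_k = P_{V_k} x - P_{V_{k+1}} x`. The piece `z_k` has its first `k` modes
constrained by a column space and, by tangency, its modes after `k + 1` constrained by a row space;
only mode `k + 1` is free. Coherence bounds its entries by one summand of `C₀`
(`sq_apply_starProjection_sub_le`), and Cauchy–Schwarz adds the summands.

Probabilistic half. The operator to be estimated is a sum of `m` independent centred terms `m⁻¹ (P -
N P e_a e_aᵀ P)`. The entry bound controls their size by `K = C₀ N / m = C₀ / ρ` and their total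
variance by `K` as well. A matrix Bernstein inequality gives failure probability at most `2 N exp
(-3 ε² / (8 K))`; the hypothesis on `ρ` makes the exponential at most `n ^ (-d β)`, while `N ≤ n ^
d`. Bernstein is proved by the Ahlswede–Winter argument: trace exponentials are peeled off one
sample at a time with Golden–Thompson, which follows from trace inequalities for powers `2 ^ k` and
the Lie–Trotter formula. Expectations appear as sums over all sample sequences. -/

theorem Matrix.trace_sq_le_trace_mul_transpose (X : Matrix ι ι ℝ) :
    (X * X).trace ≤ (X * X.transpose).trace := by
  have h : 0 ≤ ((X - X.transpose) * (X - X.transpose).transpose).trace := by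
    simp only [Matrix.trace, Matrix.diag_apply, Matrix.mul_apply, Matrix.transpose_apply]
    exact Finset.sum_nonneg fun i _ => Finset.sum_nonneg fun j _ => mul_self_nonneg _
  have h1 : (X.transpose * X.transpose).trace = (X * X).trace := by
    rw [← Matrix.transpose_mul, Matrix.trace_transpose]
  have h2 : (X.transpose * X).trace = (X * X.transpose).trace := Matrix.trace_mul_comm _ _
  rw [Matrix.transpose_sub, Matrix.transpose_transpose, sub_mul, mul_sub, mul_sub,
    Matrix.trace_sub, Matrix.trace_sub, Matrix.trace_sub, h1, h2] at h
  linarith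

theorem Matrix.trace_mul_le_of_isSymm {P Q : Matrix ι ι ℝ} (hP : P.IsSymm) (hQ : Q.IsSymm) :
    2 * (P * Q).trace ≤ (P * P).trace + (Q * Q).trace := by
  have h : 0 ≤ ((P - Q) * (P - Q).transpose).trace := by
    simp only [Matrix.trace, Matrix.diag_apply, Matrix.mul_apply, Matrix.transpose_apply]
    exact Finset.sum_nonneg fun i _ => Finset.sum_nonneg fun j _ => mul_self_nonneg _
  rw [Matrix.transpose_sub, hP.eq, hQ.eq, sub_mul, mul_sub, mul_sub,
    Matrix.trace_sub, Matrix.trace_sub, Matrix.trace_sub, Matrix.trace_mul_comm Q P] at h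
  linarith

variable [DecidableEq ι]

theorem Matrix.trace_mul_pow_comm (X Y : Matrix ι ι ℝ) (n : ℕ) :
    ((X * Y) ^ n).trace = ((Y * X) ^ n).trace := by
  cases n with
  | zero => simp
  | succ n => rw [pow_succ, ← mul_assoc, Matrix.trace_mul_comm, pow_succ, ← mul_assoc, ← mul_assoc,
      mul_pow_mul]

/-- The two claims are proved together because each one at level `k + 1` uses both at level `k`. For
the second, `X = A * B` turns `X Xᵀ` into `A B² A`, which is cyclically `A² B²`. For the first, `X²`
leads to `X Xᵀ` times `Xᵀ X`, two symmetric matrices whose powers have equal traces. -/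
theorem Matrix.trace_pow_two_pow_le (k : ℕ) :
    (∀ X : Matrix ι ι ℝ, (X ^ 2 ^ (k + 1)).trace ≤ ((X * X.transpose) ^ 2 ^ k).trace) ∧
      ∀ A B : Matrix ι ι ℝ, A.IsSymm → B.IsSymm →
        ((A * B) ^ 2 ^ k).trace ≤ (A ^ 2 ^ k * B ^ 2 ^ k).trace := by
  induction k with
  | zero =>
    refine ⟨fun X => ?_, fun A B _ _ => by simp⟩
    simpa [pow_two] using X.trace_sq_le_trace_mul_transpose
  | succ k ih =>
    obtain ⟨ih1, ih2⟩ := ih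
    have hG : ∀ A B : Matrix ι ι ℝ, A.IsSymm → B.IsSymm →
        ((A * B) ^ 2 ^ (k + 1)).trace ≤ (A ^ 2 ^ (k + 1) * B ^ 2 ^ (k + 1)).trace := by
      intro A B hA hB
      refine (ih1 (A * B)).trans ?_
      rw [Matrix.transpose_mul, hA.eq, hB.eq,
        show A * B * (B * A) = A * (B * B * A) by simp only [mul_assoc],
        Matrix.trace_mul_pow_comm, mul_assoc (B * B), Matrix.trace_mul_pow_comm]
      refine (ih2 (A * A) (B * B) ?_ ?_).trans_eq ?_
      · rw [← pow_two]; exact hA.pow 2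
      · rw [← pow_two]; exact hB.pow 2
      · rw [← pow_two, ← pow_two, ← pow_mul, ← pow_mul, pow_succ' 2 k]
    refine ⟨fun X => ?_, hG⟩
    have hP : (X.transpose * X).IsSymm := Matrix.isSymm_transpose_mul_self X
    have hQ : (X * X.transpose).IsSymm := Matrix.isSymm_mul_transpose_self X
    have h1 : (X ^ 2 ^ (k + 1 + 1)).trace ≤
        ((X * X.transpose * (X.transpose * X)) ^ 2 ^ k).trace := by
      rw [pow_succ' 2 (k + 1), pow_mul]
      refine (ih1 (X ^ 2)).trans_eq ?_
      rw [Matrix.transpose_pow, pow_two, pow_two,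
        show X * X * (X.transpose * X.transpose) = X * (X * X.transpose * X.transpose) by
          simp only [mul_assoc], Matrix.trace_mul_pow_comm]
      simp only [mul_assoc]
    refine h1.trans ((ih2 _ _ hQ hP).trans ?_)
    have h2 := Matrix.trace_mul_le_of_isSymm (hQ.pow (2 ^ k)) (hP.pow (2 ^ k))
    have h3 : (X.transpose * X) ^ 2 ^ k * (X.transpose * X) ^ 2 ^ k =
        (X.transpose * X) ^ 2 ^ (k + 1) := by rw [← pow_add, pow_succ 2 k, mul_two]
    have h4 : (X * X.transpose) ^ 2 ^ k * (X * X.transpose) ^ 2 ^ k =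
        (X * X.transpose) ^ 2 ^ (k + 1) := by rw [← pow_add, pow_succ 2 k, mul_two]
    rw [h3, h4, Matrix.trace_mul_pow_comm X.transpose X] at h2
    linarith

end TraceInequalities

/-! ### The Lie–Trotter product formula. -/

section LieTrotter

open NormedSpace Filter Topology

variable {𝔸 : Type*} [NormedRing 𝔸] [NormOneClass 𝔸]

theorem norm_pow_sub_pow_le_of_norm_le {X Y : 𝔸} {M : ℝ} (hX : ‖X‖ ≤ M) (hY : ‖Y‖ ≤ M) (n : ℕ) :
    ‖X ^ (n + 1) - Y ^ (n + 1)‖ ≤ (n + 1) * M ^ n * ‖X - Y‖ := by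
  have hM : 0 ≤ M := (norm_nonneg X).trans hX
  induction n with
  | zero => simp
  | succ n ih =>
    have h : X ^ (n + 1 + 1) - Y ^ (n + 1 + 1) =
        (X ^ (n + 1) - Y ^ (n + 1)) * X + Y ^ (n + 1) * (X - Y) := by
      rw [pow_succ X (n + 1), pow_succ Y (n + 1)]; noncomm_ring
    rw [h]
    calc _ ≤ ‖X ^ (n + 1) - Y ^ (n + 1)‖ * ‖X‖ + ‖Y‖ ^ (n + 1) * ‖X - Y‖ := by
          refine (norm_add_le _ _).trans (add_le_add (norm_mul_le _ _) ?_)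
          exact (norm_mul_le _ _).trans (by gcongr; exact norm_pow_le _ _)
      _ ≤ ((n + 1) * M ^ n * ‖X - Y‖) * M + M ^ (n + 1) * ‖X - Y‖ := by gcongr
      _ = _ := by push_cast; ring

variable [NormedAlgebra ℝ 𝔸]

theorem NormedSpace.norm_exp_le_exp_norm (x : 𝔸) : ‖exp x‖ ≤ Real.exp ‖x‖ := by
  rw [exp_eq_tsum ℝ, Real.exp_eq_exp_ℝ, exp_eq_tsum ℝ]
  refine tsum_of_norm_bounded (expSeries_summable' (𝕂 := ℝ) ‖x‖).hasSum fun n => ?_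
  rw [norm_smul, Real.norm_of_nonneg (by positivity), smul_eq_mul]
  gcongr
  exact norm_pow_le _ _

variable [CompleteSpace 𝔸]

/-- The Lie–Trotter product formula. -/
theorem tendsto_exp_mul_exp_pow (A B : 𝔸) :
    Tendsto (fun n : ℕ => (exp ((n + 1 : ℝ)⁻¹ • A) * exp ((n + 1 : ℝ)⁻¹ • B)) ^ (n + 1)) atTop
      (𝓝 (exp (A + B))) := by
  let _ : NormedAlgebra ℚ 𝔸 := NormedAlgebra.restrictScalars ℚ ℝ 𝔸
  -- The error of a single factor. It vanishes to first order at `0`, hence is `o(1/n)` at `t =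
  -- 1/(n+1)`; telescoping the power costs a factor `n + 1` and a bounded product of norms.
  set h : ℝ → 𝔸 := fun t => exp (t • A) * exp (t • B) - exp (t • (A + B)) with hh
  have hder : HasDerivAt h 0 0 := by
    have := ((hasDerivAt_exp_smul_const (𝕂 := ℝ) A 0).mul
      (hasDerivAt_exp_smul_const (𝕂 := ℝ) B 0)).sub (hasDerivAt_exp_smul_const (𝕂 := ℝ) (A + B) 0)
    simpa [hh, Pi.mul_def, Pi.sub_def] using this
  have ht : Tendsto (fun n : ℕ => (n + 1 : ℝ)⁻¹) atTop (𝓝[≠] 0) := by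
    refine tendsto_nhdsWithin_iff.2 ⟨?_, Eventually.of_forall fun n => ?_⟩
    · simpa using tendsto_one_div_add_atTop_nhds_zero_nat (𝕜 := ℝ)
    · exact inv_ne_zero (by positivity)
  have hs := (hder.tendsto_slope_zero.comp ht).norm
  simp only [norm_zero] at hs
  have hexp : ∀ (n : ℕ) (C : 𝔸), ‖exp ((n + 1 : ℝ)⁻¹ • C)‖ ≤ Real.exp ((n + 1 : ℝ)⁻¹ * ‖C‖) := by
    intro n C
    refine (norm_exp_le_exp_norm _).trans ?_
    rw [norm_smul, Real.norm_of_nonneg (by positivity)]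
  have hpow : ∀ n : ℕ, exp ((n + 1 : ℝ)⁻¹ • (A + B)) ^ (n + 1) = exp (A + B) := by
    intro n
    rw [← exp_nsmul, ← Nat.cast_smul_eq_nsmul ℝ, smul_smul]
    congr 1
    rw [Nat.cast_add_one, mul_inv_cancel₀ (by positivity), one_smul]
  rw [tendsto_iff_norm_sub_tendsto_zero]
  refine squeeze_zero (fun _ => norm_nonneg _) (fun n => ?_)
    (by simpa using hs.const_mul (Real.exp (‖A‖ + ‖B‖)))
  rw [← hpow n]
  have hM : (0 : ℝ) < n + 1 := by positivity
  refine (norm_pow_sub_pow_le_of_norm_le (M := Real.exp ((n + 1 : ℝ)⁻¹ * (‖A‖ + ‖B‖)))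
    ?_ ?_ n).trans ?_
  · rw [mul_add, Real.exp_add]
    exact (norm_mul_le _ _).trans (mul_le_mul (hexp n A) (hexp n B) (norm_nonneg _)
      (Real.exp_pos _).le)
  · exact (hexp n _).trans (Real.exp_le_exp.2 (by gcongr; exact norm_add_le _ _))
  · simp only [hh, zero_smul, exp_zero, mul_one, sub_self, sub_zero,
      norm_smul, Real.norm_of_nonneg hM.le]
    rw [mul_comm ((n : ℝ) + 1), mul_assoc]
    gcongr
    rw [← Real.exp_nat_mul]
    refine Real.exp_le_exp.2 ?_
    rw [← mul_assoc]
    refine mul_le_of_le_one_left (by positivity) ?_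
    rw [← div_eq_mul_inv, div_le_one hM]
    linarith

end LieTrotter

/-! ### The Golden–Thompson inequality. -/

section GoldenThompson

open NormedSpace Filter Topology

variable {ι : Type*} [Fintype ι] [DecidableEq ι]

attribute [local instance] Matrix.linftyOpNormedRing Matrix.linftyOpNormedAlgebra

/-- The Golden–Thompson inequality for real symmetric matrices. -/
theorem Matrix.trace_exp_add_le {A B : Matrix ι ι ℝ} (hA : A.IsSymm) (hB : B.IsSymm) :
    (exp (A + B)).trace ≤ (exp A * exp B).trace := by
  cases isEmpty_or_nonempty ι
  · simp [Matrix.trace]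
  have hc : Continuous (Matrix.trace : Matrix ι ι ℝ → ℝ) := continuous_id.matrix_trace
  have : NormOneClass (Matrix ι ι ℝ) := Matrix.linfty_opNormOneClass
  -- The product formula is indexed by the exponent `n + 1`, so the subsequence of exponents `2 ^ k`
  -- is `n = 2 ^ k - 1`.
  have h2 : Tendsto (fun k : ℕ => 2 ^ k - 1) atTop atTop :=
    (tendsto_sub_atTop_nat 1).comp (tendsto_pow_atTop_atTop_of_one_lt one_lt_two)
  refine le_of_tendsto ((hc.tendsto _).comp ((tendsto_exp_mul_exp_pow A B).comp h2))
    (Eventually.of_forall fun k => ?_)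
  have h1 : 2 ^ k - 1 + 1 = 2 ^ k := Nat.sub_add_cancel Nat.one_le_two_pow
  have h1' : (((2 ^ k - 1 : ℕ) : ℝ) + 1) = 2 ^ k := by exact_mod_cast h1
  simp only [Function.comp_apply]
  rw [h1', h1]
  refine ((Matrix.trace_pow_two_pow_le k).2 _ _ (hA.smul _).exp (hB.smul _).exp).trans_eq ?_
  have h3 : ∀ C : Matrix ι ι ℝ, exp (((2 : ℝ) ^ k)⁻¹ • C) ^ 2 ^ k = exp C := by
    intro C
    rw [← Matrix.exp_nsmul, ← Nat.cast_smul_eq_nsmul ℝ, smul_smul]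
    congr 1
    rw [Nat.cast_pow, Nat.cast_ofNat, mul_inv_cancel₀ (by positivity), one_smul]
  rw [h3, h3]

end GoldenThompson

/-! ### The matrix Bernstein inequality in counting form. -/

section MatrixBernstein

open NormedSpace
open scoped MatrixOrder

/-- The scalar input of Bernstein's inequality; `x` needs no lower bound. For `x ≤ 0` the
coefficient `1/2` suffices, because `(1 + x + x²/2)(1 - x + x²/2) ≥ 1`. For `x ≥ 0` a third-order
Taylor estimate is compared with the coefficient. -/
theorem Real.exp_le_one_add_add_sq_div {b x : ℝ} (hb0 : 0 ≤ b) (hb : b ≤ 1) (hx : x ≤ b) :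
    Real.exp x ≤ 1 + x + 1 / (2 * (1 - b / 3)) * x ^ 2 := by
  rcases le_total x 0 with h | h
  · have h1 : Real.exp x ≤ 1 + x + x ^ 2 / 2 := by
      have h2 := Real.quadratic_le_exp_of_nonneg (neg_nonneg.2 h)
      have h3 : Real.exp x * Real.exp (-x) = 1 := by rw [← Real.exp_add]; simp
      have h4 : 0 < Real.exp x := Real.exp_pos x
      have h5 : Real.exp x * (1 + -x + (-x) ^ 2 / 2) ≤ 1 :=
        (mul_le_mul_of_nonneg_left h2 h4.le).trans_eq h3
      have h6 : 0 < 1 + -x + (-x) ^ 2 / 2 := by nlinarith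
      have h7 : 1 ≤ (1 + x + x ^ 2 / 2) * (1 + -x + (-x) ^ 2 / 2) := by
        have : (1 + x + x ^ 2 / 2) * (1 + -x + (-x) ^ 2 / 2) = 1 + (x ^ 2) ^ 2 / 4 := by ring
        rw [this]; nlinarith [sq_nonneg (x ^ 2)]
      exact le_of_mul_le_mul_right (h5.trans h7) h6
    have h2 : 1 / 2 ≤ 1 / (2 * (1 - b / 3)) :=
      one_div_le_one_div_of_le (by linarith) (by linarith)
    nlinarith [sq_nonneg x]
  · have h1 := Real.exp_bound' h (hx.trans hb) (n := 4) (by norm_num)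
    norm_num [Finset.sum_range_succ, Nat.factorial] at h1
    have hx1 : x ≤ 1 := hx.trans hb
    -- The constant `5 / 96` is the remainder coefficient `(n + 1) / (n! * n)` at `n = 4`.
    have h2 : 1 / 2 + x / 6 + 5 / 96 * x ^ 2 ≤ 1 / (2 * (1 - b / 3)) := by
      rw [le_div_iff₀ (by linarith)]
      have h3 : 2 * (1 - b / 3) ≤ 2 * (1 - x / 3) := by linarith
      calc _ ≤ (1 / 2 + x / 6 + 5 / 96 * x ^ 2) * (2 * (1 - x / 3)) := by gcongr
        _ = 1 - x ^ 2 / 144 - 5 / 144 * x ^ 3 := by ring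
        _ ≤ 1 := by nlinarith [sq_nonneg x, pow_nonneg h 3]
    nlinarith [sq_nonneg x, mul_le_mul_of_nonneg_right h2 (sq_nonneg x)]

variable {ι : Type*}

theorem Matrix.IsHermitian.isSymm_of_real {A : Matrix ι ι ℝ} (hA : A.IsHermitian) : A.IsSymm := by
  rw [Matrix.IsSymm, ← Matrix.conjTranspose_eq_transpose_of_trivial]
  exact hA

variable [Fintype ι] [DecidableEq ι]

theorem Matrix.IsHermitian.eq_unitary_mul_diagonal_mul {A : Matrix ι ι ℝ} (hA : A.IsHermitian) :
    A = (hA.eigenvectorUnitary : Matrix ι ι ℝ) * Matrix.diagonal hA.eigenvalues *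
      star (hA.eigenvectorUnitary : Matrix ι ι ℝ) := by
  conv_lhs => rw [hA.spectral_theorem, Unitary.conjStarAlgAut_apply]
  rfl

theorem Matrix.IsHermitian.exp_smul_eq {A : Matrix ι ι ℝ} (hA : A.IsHermitian) (t : ℝ) :
    NormedSpace.exp (t • A) = (hA.eigenvectorUnitary : Matrix ι ι ℝ) *
      Matrix.diagonal (fun i => Real.exp (t * hA.eigenvalues i)) *
      star (hA.eigenvectorUnitary : Matrix ι ι ℝ) := by
  set U := hA.eigenvectorUnitary
  have hU : (U : Matrix ι ι ℝ)⁻¹ = star (U : Matrix ι ι ℝ) :=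
    Matrix.inv_eq_right_inv (Unitary.mul_star_self_of_mem U.2)
  have hUu : IsUnit (U : Matrix ι ι ℝ) := (Unitary.toUnits U).isUnit
  have h : A = U * Matrix.diagonal hA.eigenvalues * star (U : Matrix ι ι ℝ) :=
    hA.eq_unitary_mul_diagonal_mul
  conv_lhs => rw [h, ← hU, ← smul_mul_assoc, ← mul_smul_comm, ← Matrix.diagonal_smul,
    Matrix.exp_conj _ _ hUu, Matrix.exp_diagonal, hU]
  congr 3
  ext i
  rw [Pi.coe_exp, ← Real.exp_eq_exp_ℝ]
  rfl

theorem Matrix.IsHermitian.trace_exp_smul {A : Matrix ι ι ℝ} (hA : A.IsHermitian) (t : ℝ) :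
    (NormedSpace.exp (t • A)).trace = ∑ i, Real.exp (t * hA.eigenvalues i) := by
  rw [hA.exp_smul_eq, Matrix.trace_mul_comm, ← mul_assoc, Unitary.coe_star_mul_self, one_mul,
    Matrix.trace_diagonal]

theorem Matrix.IsHermitian.eigenvalues_le {A : Matrix ι ι ℝ} (hA : A.IsHermitian) {b : ℝ}
    (hb : A ≤ b • (1 : Matrix ι ι ℝ)) (i : ι) : hA.eigenvalues i ≤ b := by
  have h := (Matrix.le_iff.1 hb).dotProduct_mulVec_nonneg (hA.eigenvectorBasis i).ofLp
  have h1 : (hA.eigenvectorBasis i).ofLp ⬝ᵥ (hA.eigenvectorBasis i).ofLp = 1 := by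
    have := hA.eigenvectorBasis.orthonormal.1 i
    rw [EuclideanSpace.norm_eq, Real.sqrt_eq_one] at this
    simpa [dotProduct, pow_two] using this
  rw [Matrix.sub_mulVec, Matrix.smul_mulVec, Matrix.one_mulVec, hA.mulVec_eigenvectorBasis,
    star_trivial, dotProduct_sub, dotProduct_smul, dotProduct_smul, h1] at h
  simpa using h

theorem Matrix.IsHermitian.exp_le {A : Matrix ι ι ℝ} (hA : A.IsHermitian) {b : ℝ} (hb0 : 0 ≤ b)
    (hb1 : b ≤ 1) (hb : A ≤ b • (1 : Matrix ι ι ℝ)) :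
    NormedSpace.exp A ≤ 1 + A + (1 / (2 * (1 - b / 3))) • (A * A) := by
  rw [Matrix.le_iff]
  set U := hA.eigenvectorUnitary
  set D := Matrix.diagonal hA.eigenvalues
  set c := 1 / (2 * (1 - b / 3))
  have hUU : (U : Matrix ι ι ℝ) * star (U : Matrix ι ι ℝ) = 1 :=
    Unitary.mul_star_self_of_mem U.2
  have hUU' : star (U : Matrix ι ι ℝ) * (U : Matrix ι ι ℝ) = 1 :=
    Unitary.star_mul_self_of_mem U.2
  have h1 : A = U * D * star (U : Matrix ι ι ℝ) := hA.eq_unitary_mul_diagonal_mul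
  have h2 : A * A = U * (D * D) * star (U : Matrix ι ι ℝ) := by
    conv_lhs => rw [h1]
    calc _ = U * D * (star (U : Matrix ι ι ℝ) * U) * D * star (U : Matrix ι ι ℝ) := by
          simp only [mul_assoc]
      _ = _ := by rw [hUU']; simp only [mul_assoc, one_mul]
  have h3 := hA.exp_smul_eq 1
  simp only [one_smul, one_mul] at h3
  have h4 : 1 + A + c • (A * A) - NormedSpace.exp A = U * (1 + D + c • (D * D) -
      Matrix.diagonal (fun i => Real.exp (hA.eigenvalues i))) * star (U : Matrix ι ι ℝ) := by
    rw [mul_sub, sub_mul, mul_add, mul_add, add_mul, add_mul, mul_one, hUU, ← h1, mul_smul_comm,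
      smul_mul_assoc, ← h2, ← h3]
  rw [h4, Matrix.star_eq_conjTranspose]
  refine Matrix.PosSemidef.mul_mul_conjTranspose_same ?_ _
  have h5 : 1 + D + c • (D * D) - Matrix.diagonal (fun i => Real.exp (hA.eigenvalues i)) =
      Matrix.diagonal (fun i => 1 + hA.eigenvalues i + c * hA.eigenvalues i ^ 2 -
        Real.exp (hA.eigenvalues i)) := by
    simp only [D, Matrix.diagonal_mul_diagonal, ← Matrix.diagonal_one, ← Matrix.diagonal_smul,
      Matrix.diagonal_add, Matrix.diagonal_sub]
    congr 1
    ext i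
    simp [pow_two]
  rw [h5]
  exact Matrix.PosSemidef.diagonal fun i =>
    sub_nonneg.2 (Real.exp_le_one_add_add_sq_div hb0 hb1 (hA.eigenvalues_le hb i))

/-- With `R = exp (H / 2)`, the difference of the two sides is the trace of the positive
semidefinite matrix `R (c - M) R`. -/
theorem Matrix.trace_exp_mul_le {H M : Matrix ι ι ℝ} (hH : H.IsHermitian) {c : ℝ}
    (hM : M ≤ c • (1 : Matrix ι ι ℝ)) : (exp H * M).trace ≤ c * (exp H).trace := by
  set R := exp ((1 / 2 : ℝ) • H) with hR
  have hRR : R * R = exp H := by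
    rw [hR, ← pow_two, ← Matrix.exp_nsmul, ← Nat.cast_smul_eq_nsmul ℝ, smul_smul]
    norm_num
  have hRh : R.conjTranspose = R := (Matrix.IsHermitian.exp (by
    rw [Matrix.IsHermitian, Matrix.conjTranspose_smul, hH.eq, star_trivial])).eq
  have h := ((Matrix.le_iff.1 hM).mul_mul_conjTranspose_same R).trace_nonneg
  rw [hRh, mul_sub, sub_mul, Matrix.trace_sub, Matrix.trace_mul_comm (R * M), ← mul_assoc, hRR,
    mul_smul_comm, mul_one, smul_mul_assoc, hRR, Matrix.trace_smul, smul_eq_mul] at h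
  linarith

variable {σ : Type*} [Fintype σ]

/-- Ahlswede–Winter iteration: Golden–Thompson splits off the factor of one sample, and summing over
that sample alone replaces it by `∑ i, exp (X i)`, which costs a factor `c`. -/
theorem Matrix.sum_trace_exp_sum_le {X : σ → Matrix ι ι ℝ} (hX : ∀ i, (X i).IsHermitian) {c : ℝ}
    (hc0 : 0 ≤ c) (hc : ∑ i, exp (X i) ≤ c • (1 : Matrix ι ι ℝ)) (m : ℕ) :
    ∑ w : Fin m → σ, (exp (∑ j, X (w j))).trace ≤ c ^ m * Fintype.card ι := by
  induction m with
  | zero => simp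
  | succ m ih =>
    have hs : ∀ w : Fin m → σ, (∑ j, X (w j)).IsHermitian := fun w => by
      rw [Matrix.IsHermitian, Matrix.conjTranspose_sum]
      exact Finset.sum_congr rfl fun j _ => (hX _).eq
    calc ∑ w : Fin (m + 1) → σ, (exp (∑ j, X (w j))).trace
        = ∑ i, ∑ w : Fin m → σ, (exp (X i + ∑ j, X (w j))).trace := by
          rw [← (Fin.consEquiv fun _ => σ).sum_comp, Fintype.sum_prod_type]
          simp [Fin.sum_univ_succ, Fin.consEquiv]
      _ ≤ ∑ i, ∑ w : Fin m → σ, (exp (∑ j, X (w j)) * exp (X i)).trace := by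
          refine Finset.sum_le_sum fun i _ => Finset.sum_le_sum fun w _ => ?_
          rw [add_comm]
          exact Matrix.trace_exp_add_le (hs w).isSymm_of_real (hX i).isSymm_of_real
      _ = ∑ w : Fin m → σ, (exp (∑ j, X (w j)) * ∑ i, exp (X i)).trace := by
          rw [Finset.sum_comm]
          simp only [Finset.mul_sum, Matrix.trace_sum]
      _ ≤ ∑ w : Fin m → σ, c * (exp (∑ j, X (w j))).trace :=
          Finset.sum_le_sum fun w _ => Matrix.trace_exp_mul_le (hs w) hc
      _ ≤ c ^ (m + 1) * Fintype.card ι := by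
          rw [← Finset.mul_sum, pow_succ', mul_assoc]
          gcongr

/-- Some eigenvalue has absolute value at least `ε`; depending on its sign it is seen by one of the
two traces, and all other terms are positive. -/
theorem Matrix.exp_le_trace_exp_of_le_norm {Y : Matrix ι ι ℝ} (hY : Y.IsHermitian) {ε θ : ℝ}
    (hε : 0 < ε) (hθ : 0 ≤ θ) (h : ε ≤ ‖Matrix.toEuclideanCLM (𝕜 := ℝ) Y‖) :
    Real.exp (θ * ε) ≤ (exp (θ • Y)).trace + (exp ((-θ) • Y)).trace := by
  have hn : ‖Matrix.toEuclideanCLM (𝕜 := ℝ) Y‖ = ‖hY.eigenvalues‖ := by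
    open scoped Matrix.Norms.L2Operator in
    rw [Matrix.l2_opNorm_toEuclideanCLM]
    conv_lhs => rw [hY.eq_unitary_mul_diagonal_mul]
    rw [← Unitary.coe_star, CStarRing.norm_mul_coe_unitary, CStarRing.norm_coe_unitary_mul,
      Matrix.l2_opNorm_diagonal]
  rw [hn] at h
  obtain ⟨i, hi⟩ : ∃ i, ε ≤ ‖hY.eigenvalues i‖ := by
    by_contra! hcon
    exact absurd ((pi_norm_lt_iff hε).2 hcon) (not_lt.2 h)
  have hle : ∀ t, Real.exp (t * hY.eigenvalues i) ≤ (exp (t • Y)).trace := fun t => by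
    rw [hY.trace_exp_smul]
    exact Finset.single_le_sum (f := fun i => Real.exp (t * hY.eigenvalues i))
      (fun _ _ => (Real.exp_pos _).le) (Finset.mem_univ i)
  have hpos : ∀ t, 0 ≤ (exp (t • Y)).trace := fun t => (Real.exp_pos _).le.trans (hle t)
  rw [Real.norm_eq_abs] at hi
  rcases le_abs.1 hi with h' | h'
  · have : Real.exp (θ * ε) ≤ Real.exp (θ * hY.eigenvalues i) := Real.exp_le_exp.2 (by gcongr)
    linarith [hle θ, hpos (-θ)]
  · have : Real.exp (θ * ε) ≤ Real.exp (-θ * hY.eigenvalues i) :=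
      Real.exp_le_exp.2 (by nlinarith)
    linarith [hle (-θ), hpos θ]

theorem Matrix.sum_trace_exp_smul_sum_le {X : σ → Matrix ι ι ℝ} (hX : ∀ i, (X i).IsHermitian)
    {K ε : ℝ} (hK : 0 < K) (hε : 0 < ε) (hε1 : ε < 1) (h0 : ∑ i, X i = 0)
    (hle : ∀ i, X i ≤ K • (1 : Matrix ι ι ℝ)) {m : ℕ} (hm : 0 < m)
    (hv : ∑ i, X i * X i ≤ (Fintype.card σ * K / m : ℝ) • (1 : Matrix ι ι ℝ)) :
    ∑ w : Fin m → σ, (exp ((3 * ε / (4 * K)) • ∑ j, X (w j))).trace ≤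
      (Fintype.card σ : ℝ) ^ m * Real.exp (3 * ε ^ 2 / (8 * K)) * Fintype.card ι := by
  -- This choice gives `θ * K = 3 ε / 4 ≤ 1`, as the scalar inequality requires, and then `c ≤ 2 /
  -- 3` because `ε < 1`.
  set θ := 3 * ε / (4 * K) with hθ
  have hθ0 : 0 < θ := by positivity
  set c := 1 / (2 * (1 - (3 * ε / 4) / 3)) with hc
  have hc0 : 0 ≤ c := by rw [hc]; refine one_div_nonneg.2 ?_; linarith
  have hc1 : c ≤ 2 / 3 := by
    rw [hc, div_le_iff₀ (by linarith)]; linarith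
  have hm' : (0 : ℝ) < m := by exact_mod_cast hm
  have hherm : ∀ i, (θ • X i).IsHermitian := fun i => by
    rw [Matrix.IsHermitian, Matrix.conjTranspose_smul, (hX i).eq, star_trivial]
  have h1 : ∀ i, exp (θ • X i) ≤ 1 + θ • X i + c • ((θ • X i) * (θ • X i)) := fun i => by
    refine (hherm i).exp_le (by positivity) (by linarith) ?_
    have := smul_le_smul_of_nonneg_left (hle i) hθ0.le
    rwa [smul_smul, show θ * K = 3 * ε / 4 by rw [hθ]; field_simp] at this
  have h2 : ∑ i, exp (θ • X i) ≤
      (Fintype.card σ * Real.exp (c * θ ^ 2 * K / m)) • (1 : Matrix ι ι ℝ) := by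
    refine (Finset.sum_le_sum fun i _ => h1 i).trans ?_
    have h3 : ∑ i, (1 + θ • X i + c • ((θ • X i) * (θ • X i))) =
        (Fintype.card σ : ℝ) • (1 : Matrix ι ι ℝ) + (c * θ ^ 2) • ∑ i, X i * X i := by
      simp only [smul_mul_smul_comm, smul_smul, Finset.sum_add_distrib, ← Finset.smul_sum, h0,
        smul_zero, add_zero, Finset.sum_const, Finset.card_univ, Nat.cast_smul_eq_nsmul, pow_two]
    rw [h3]
    refine (add_le_add_right (smul_le_smul_of_nonneg_left hv (by positivity)) _).trans ?_
    rw [smul_smul, ← add_smul]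
    refine smul_le_smul_of_nonneg_right ?_ zero_le_one
    have := Real.add_one_le_exp (c * θ ^ 2 * K / m)
    calc _ = (Fintype.card σ : ℝ) * (c * θ ^ 2 * K / m + 1) := by ring
      _ ≤ _ := by gcongr
  have h3 := Matrix.sum_trace_exp_sum_le hherm (by positivity) h2 m
  simp only [Finset.smul_sum]
  refine h3.trans ?_
  rw [mul_pow, ← Real.exp_nat_mul]
  gcongr
  calc (m : ℝ) * (c * θ ^ 2 * K / m) = c * (9 * ε ^ 2 / (16 * K)) := by rw [hθ]; field_simp; ring
    _ ≤ 2 / 3 * (9 * ε ^ 2 / (16 * K)) := by gcongr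
    _ = _ := by field_simp; ring

/-- The matrix Bernstein inequality for independent samples, drawn uniformly and with replacement
from a finite family of symmetric matrices, in counting form. -/
theorem Matrix.card_norm_sum_ge_le {X : σ → Matrix ι ι ℝ} (hX : ∀ i, (X i).IsHermitian)
    {K ε : ℝ} (hK : 0 < K) (hε : 0 < ε) (hε1 : ε < 1) (h0 : ∑ i, X i = 0)
    (hle : ∀ i, X i ≤ K • (1 : Matrix ι ι ℝ)) (hge : ∀ i, -X i ≤ K • (1 : Matrix ι ι ℝ))
    {m : ℕ} (hm : 0 < m)
    (hv : ∑ i, X i * X i ≤ (Fintype.card σ * K / m : ℝ) • (1 : Matrix ι ι ℝ)) :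
    (Nat.card {w : Fin m → σ // ε ≤ ‖Matrix.toEuclideanCLM (𝕜 := ℝ) (∑ j, X (w j))‖} : ℝ) ≤
      2 * Fintype.card ι * (Fintype.card σ : ℝ) ^ m * Real.exp (-(3 * ε ^ 2 / (8 * K))) := by
  classical
  set θ := 3 * ε / (4 * K) with hθ
  have hs : ∀ w : Fin m → σ, (∑ j, X (w j)).IsHermitian := fun w => by
    rw [Matrix.IsHermitian, Matrix.conjTranspose_sum]
    exact Finset.sum_congr rfl fun j _ => (hX _).eq
  have h1 := Matrix.sum_trace_exp_smul_sum_le hX hK hε hε1 h0 hle hm hv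
  have h2 := Matrix.sum_trace_exp_smul_sum_le (X := fun i => -X i) (fun i => (hX i).neg) hK hε hε1
    (by simp [h0]) hge hm (by simpa using hv)
  rw [← hθ] at h1 h2
  simp only [Finset.sum_neg_distrib, smul_neg, ← neg_smul] at h2
  set B := Finset.univ.filter fun w : Fin m → σ =>
    ε ≤ ‖Matrix.toEuclideanCLM (𝕜 := ℝ) (∑ j, X (w j))‖ with hB
  have hcard : Nat.card {w : Fin m → σ // ε ≤ ‖Matrix.toEuclideanCLM (𝕜 := ℝ) (∑ j, X (w j))‖} =
      B.card := by rw [Nat.card_eq_fintype_card, Fintype.card_subtype]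
  rw [hcard]
  have h3 : (B.card : ℝ) * Real.exp (θ * ε) ≤ ∑ w : Fin m → σ,
      ((exp (θ • ∑ j, X (w j))).trace + (exp ((-θ) • ∑ j, X (w j))).trace) := by
    rw [← nsmul_eq_mul, ← Finset.sum_const]
    refine (Finset.sum_le_sum fun w hw => Matrix.exp_le_trace_exp_of_le_norm (hs w) hε
      (by positivity) (Finset.mem_filter.1 hw).2).trans ?_
    refine Finset.sum_le_sum_of_subset_of_nonneg (Finset.subset_univ _) fun w _ _ => ?_
    rw [(hs w).trace_exp_smul, (hs w).trace_exp_smul]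
    positivity
  rw [Finset.sum_add_distrib] at h3
  -- Here `θ * ε` is exactly twice `3 ε² / (8 K)`, so half of the exponential gain survives the
  -- moment bound.
  have h4 : Real.exp (-(3 * ε ^ 2 / (8 * K))) * Real.exp (θ * ε) =
      Real.exp (3 * ε ^ 2 / (8 * K)) := by
    rw [← Real.exp_add]; congr 1; rw [hθ]; field_simp; ring
  refine le_of_mul_le_mul_right ?_ (Real.exp_pos (θ * ε))
  calc _ ≤ _ := h3.trans (add_le_add h1 h2)
    _ = 2 * Fintype.card ι * (Fintype.card σ : ℝ) ^ m * Real.exp (3 * ε ^ 2 / (8 * K)) := by ring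
    _ = _ := by rw [← h4]; ring

end MatrixBernstein

/-! ### First-order variation of operators of constant rank. -/

section ConstantRank

open Filter Topology

variable {E F : Type*} [NormedAddCommGroup E] [InnerProductSpace ℝ E] [FiniteDimensional ℝ E]
  [NormedAddCommGroup F] [InnerProductSpace ℝ F]

theorem ContinuousLinearMap.exists_mul_norm_le_of_mem_ker_orthogonal (A : E →L[ℝ] F) :
    ∃ c > 0, ∀ x ∈ A.kerᗮ, c * ‖x‖ ≤ ‖A x‖ := by
  have hinj : LinearMap.ker ((A : E →ₗ[ℝ] F).domRestrict A.kerᗮ) = ⊥ := by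
    rw [LinearMap.ker_eq_bot']
    rintro ⟨x, hx⟩ h0
    have hx0 : x ∈ A.ker := h0
    have := Submodule.inner_right_of_mem_orthogonal hx0 hx
    simpa using this
  obtain ⟨K, hK0, hK⟩ := LinearMap.exists_antilipschitzWith _ hinj
  have hKpos : (0 : ℝ) < K := hK0
  refine ⟨(K : ℝ)⁻¹, inv_pos.2 hKpos, fun x hx => ?_⟩
  have := hK.le_mul_dist ⟨x, hx⟩ 0
  rw [map_zero, dist_zero_right, dist_zero_right] at this
  rw [inv_mul_le_iff₀ hKpos]
  exact this

/-- Near `A` and with equal rank, `B` is still injective on the complement of `ker A`, so by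
dimension it maps that complement onto its whole range. Thus `B w = B x` with `x` there and `‖x‖`
controlled by `‖B w‖`; since `φ` kills the range of `A`, `φ (B w) = φ ((B - A) x)`. When `A w = 0`
this is of second order in `B - A`. -/
theorem ContinuousLinearMap.norm_apply_le_of_finrank_range_eq [FiniteDimensional ℝ F]
    {A B : E →L[ℝ] F} {c : ℝ} (hc : 0 < c) (hA : ∀ x ∈ A.kerᗮ, c * ‖x‖ ≤ ‖A x‖)
    (hAB : ‖B - A‖ ≤ c / 2) (hrank : Module.finrank ℝ B.range = Module.finrank ℝ A.range) (w : E)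
    {φ : F →L[ℝ] ℝ} (hφ : ∀ v, φ (A v) = 0) :
    ‖φ (B w)‖ ≤ ‖φ‖ * (‖B - A‖ * (2 / c * ‖B w‖)) := by
  have hrankC : Module.finrank ℝ A.kerᗮ = Module.finrank ℝ A.range := by
    have h1 := Submodule.finrank_add_finrank_orthogonal A.ker
    have h2 : Module.finrank ℝ A.range + Module.finrank ℝ A.ker = Module.finrank ℝ E :=
      LinearMap.finrank_range_add_finrank_ker (A : E →ₗ[ℝ] F)
    omega
  have hlow : ∀ x ∈ A.kerᗮ, c / 2 * ‖x‖ ≤ ‖B x‖ := fun x hx => by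
    have h1 := hA x hx
    have h2 : ‖(B - A) x‖ ≤ c / 2 * ‖x‖ := ((B - A).le_opNorm x).trans (by gcongr)
    have h3 : ‖A x‖ ≤ ‖B x‖ + ‖(B - A) x‖ := by
      have := norm_sub_le (B x) ((B - A) x)
      rwa [← sub_apply, sub_sub_cancel] at this
    linarith
  have hmap : A.kerᗮ.map (B : E →ₗ[ℝ] F) = B.range := by
    refine Submodule.eq_of_le_of_finrank_le ?_ ?_
    · rintro _ ⟨x, _, rfl⟩
      exact ⟨x, rfl⟩
    · rw [hrank, ← hrankC]
      have hi : Function.Injective ((B : E →ₗ[ℝ] F).domRestrict A.kerᗮ) := by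
        rw [← LinearMap.ker_eq_bot, LinearMap.ker_eq_bot']
        rintro ⟨x, hx⟩ h0
        have hx0 : B x = 0 := h0
        have := hlow x hx
        rw [hx0, norm_zero] at this
        have : ‖x‖ = 0 := le_antisymm (by nlinarith [norm_nonneg x]) (norm_nonneg x)
        simpa using this
      rw [← LinearMap.finrank_range_of_inj hi, LinearMap.range_domRestrict]
  obtain ⟨x, hx, hxw⟩ : B w ∈ A.kerᗮ.map (B : E →ₗ[ℝ] F) := hmap ▸ ⟨w, rfl⟩
  have hxw' : B x = B w := hxw
  have hxn : ‖x‖ ≤ 2 / c * ‖B w‖ := by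
    have := hlow x hx
    rw [hxw'] at this
    rw [div_mul_eq_mul_div, le_div_iff₀ hc]
    linarith
  have h1 : φ (B w) = φ ((B - A) x) := by
    rw [sub_apply, map_sub, hφ, sub_zero, hxw']
  rw [h1]
  calc _ ≤ ‖φ‖ * ‖(B - A) x‖ := φ.le_opNorm _
    _ ≤ ‖φ‖ * (‖B - A‖ * ‖x‖) := by gcongr; exact (B - A).le_opNorm x
    _ ≤ _ := by gcongr

/-- The velocity at `0` of a curve of operators of constant rank maps the kernel of `G 0` into its
range. -/
theorem HasDerivAt.apply_apply_eq_zero_of_finrank_range_eq [FiniteDimensional ℝ F]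
    {G : ℝ → E →L[ℝ] F} {Y : E →L[ℝ] F} (hG : HasDerivAt G Y 0)
    (hrank : ∀ t, Module.finrank ℝ (G t).range = Module.finrank ℝ (G 0).range)
    {w : E} (hw : G 0 w = 0) {φ : F →L[ℝ] ℝ} (hφ : ∀ v, φ (G 0 v) = 0) : φ (Y w) = 0 := by
  obtain ⟨c, hc, hlow⟩ := (G 0).exists_mul_norm_le_of_mem_ker_orthogonal
  have hnear : ∀ᶠ t in 𝓝 (0 : ℝ), ‖G t - G 0‖ < c / 2 := by
    have h := (hG.continuousAt.tendsto.sub_const (G 0)).norm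
    rw [sub_self, norm_zero] at h
    exact h.eventually_lt_const (by positivity)
  have hslope : Tendsto (fun t : ℝ => t⁻¹ • (G t - G 0)) (𝓝[≠] 0) (𝓝 Y) := by
    simpa using hG.tendsto_slope_zero
  have hc1 : Continuous fun T : E →L[ℝ] F => ‖φ (T w)‖ := by fun_prop
  have hc2 : Continuous fun T : E →L[ℝ] F => ‖T w‖ := by fun_prop
  have hleft : Tendsto (fun t : ℝ => ‖φ ((t⁻¹ • (G t - G 0)) w)‖) (𝓝[≠] 0) (𝓝 ‖φ (Y w)‖) :=
    (hc1.tendsto Y).comp hslope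
  have hGw : Tendsto (fun t : ℝ => ‖G t w‖) (𝓝[≠] 0) (𝓝 0) := by
    have h1 := (hc2.tendsto (G 0)).comp hG.continuousAt.tendsto
    rw [hw, norm_zero] at h1
    exact h1.mono_left nhdsWithin_le_nhds
  -- The difference quotient stays bounded while `G t w` tends to `G 0 w = 0`; this is where the
  -- second-order estimate pays off.
  have hright : Tendsto (fun t : ℝ => ‖φ‖ * (‖t⁻¹ • (G t - G 0)‖ * (2 / c * ‖G t w‖)))
      (𝓝[≠] 0) (𝓝 0) := by
    simpa using (hslope.norm.mul (hGw.const_mul (2 / c))).const_mul ‖φ‖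
  have hle : ‖φ (Y w)‖ ≤ 0 := by
    refine le_of_tendsto_of_tendsto hleft hright ?_
    filter_upwards [nhdsWithin_le_nhds hnear] with t ht
    have := ContinuousLinearMap.norm_apply_le_of_finrank_range_eq hc hlow ht.le (hrank t) w hφ
    rw [smul_apply, map_smul, sub_apply, hw, sub_zero, norm_smul, norm_smul]
    calc _ ≤ ‖t⁻¹‖ * (‖φ‖ * (‖G t - G 0‖ * (2 / c * ‖G t w‖))) := by gcongr
      _ = _ := by ring
  simpa using hle

end ConstantRank

/-! ### Orthogonal decomposition along a decreasing chain of subspaces. -/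

section NestedProjections

variable {E : Type*} [NormedAddCommGroup E] [InnerProductSpace ℝ E] [FiniteDimensional ℝ E]

theorem Submodule.norm_starProjection_sub_sq {U V : Submodule ℝ E} (h : U ≤ V) (x : E) :
    ‖V.starProjection x - U.starProjection x‖ ^ 2 =
      ‖V.starProjection x‖ ^ 2 - ‖U.starProjection x‖ ^ 2 := by
  have h1 : U.starProjection (V.starProjection x) = U.starProjection x :=
    congrArg (fun f => f x) (Submodule.starProjection_comp_starProjection_of_le h)
  have h2 : inner ℝ (V.starProjection x - U.starProjection x) (U.starProjection x) = 0 := by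
    have := Submodule.starProjection_inner_eq_zero (K := U) (V.starProjection x) _
      (U.starProjection_apply_mem x)
    rwa [h1] at this
  have h3 := norm_add_sq_real (V.starProjection x - U.starProjection x) (U.starProjection x)
  rw [h2, sub_add_cancel] at h3
  linarith

theorem Submodule.sum_norm_starProjection_sub_sq {S : ℕ → Submodule ℝ E} {d : ℕ} (h0 : S 0 = ⊤)
    (hd : S d = ⊥) (hS : ∀ k < d, S (k + 1) ≤ S k) (x : E) :
    ∑ k ∈ Finset.range d, ‖(S k).starProjection x - (S (k + 1)).starProjection x‖ ^ 2 =
      ‖x‖ ^ 2 := by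
  have hx : (S 0).starProjection x = x :=
    Submodule.starProjection_eq_self_iff.2 (h0 ▸ Submodule.mem_top)
  rw [Finset.sum_congr rfl fun k hk =>
    Submodule.norm_starProjection_sub_sq (hS k (Finset.mem_range.1 hk)) x,
    Finset.sum_range_sub' (fun k => ‖(S k).starProjection x‖ ^ 2), hx, hd]
  simp

theorem Submodule.sum_starProjection_sub {S : ℕ → Submodule ℝ E} {d : ℕ} (h0 : S 0 = ⊤)
    (hd : S d = ⊥) (x : E) :
    ∑ k ∈ Finset.range d, ((S k).starProjection x - (S (k + 1)).starProjection x) = x := by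
  have hx : (S 0).starProjection x = x :=
    Submodule.starProjection_eq_self_iff.2 (h0 ▸ Submodule.mem_top)
  rw [Finset.sum_range_sub' (fun k => (S k).starProjection x), hx, hd]
  simp

end NestedProjections

/-! ### Splitting multi-indices; tensors with prescribed column or row spaces. -/

namespace TensorTrain

variable {n : ℕ → ℕ} {d : ℕ}

/-- The first `k` components of a multi-index. -/
def leftPart (k : ℕ) (hk : k ≤ d) (l : MultiIndex n (Finset.Icc 1 d)) :
    MultiIndex n (Finset.Icc 1 k) := fun a =>
  l ⟨a, Finset.mem_Icc.2 ⟨(Finset.mem_Icc.1 a.2).1, (Finset.mem_Icc.1 a.2).2.trans hk⟩⟩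

/-- The components of a multi-index after the first `k` ones. -/
def rightPart (k : ℕ) (l : MultiIndex n (Finset.Icc 1 d)) :
    MultiIndex n (Finset.Icc (k + 1) d) := fun a =>
  l ⟨a, Finset.mem_Icc.2 ⟨(Nat.le_add_left 1 k).trans (Finset.mem_Icc.1 a.2).1,
    (Finset.mem_Icc.1 a.2).2⟩⟩

theorem concat_leftPart_rightPart {k : ℕ} (hk : k ≤ d) (l : MultiIndex n (Finset.Icc 1 d)) :
    concat k (leftPart k hk l) (rightPart k l) = l := by
  funext a
  simp only [concat, leftPart, rightPart]
  split_ifs <;> rfl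

theorem leftPart_concat {k : ℕ} (hk : k ≤ d) (i : MultiIndex n (Finset.Icc 1 k))
    (j : MultiIndex n (Finset.Icc (k + 1) d)) : leftPart k hk (concat k i j) = i := by
  funext a
  simp only [concat, leftPart, dif_pos (Finset.mem_Icc.1 a.2).2]

theorem rightPart_concat {k : ℕ} (i : MultiIndex n (Finset.Icc 1 k))
    (j : MultiIndex n (Finset.Icc (k + 1) d)) : rightPart k (concat k i j) = j := by
  funext a
  simp only [concat, rightPart, dif_neg (not_le.2 (Nat.lt_of_succ_le (Finset.mem_Icc.1 a.2).1))]

theorem leftPart_concat_of_le {k' k : ℕ} (hk' : k' ≤ k) (hk : k ≤ d)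
    (i : MultiIndex n (Finset.Icc 1 k)) (j : MultiIndex n (Finset.Icc (k + 1) d)) :
    leftPart k' (hk'.trans hk) (concat k i j) = leftPart k' hk' i := by
  funext a
  simp only [concat, leftPart, dif_pos ((Finset.mem_Icc.1 a.2).2.trans hk')]

theorem concat_rightPart_concat {k' k : ℕ} (hk' : k' ≤ k) (i' : MultiIndex n (Finset.Icc 1 k'))
    (i : MultiIndex n (Finset.Icc 1 k)) (j : MultiIndex n (Finset.Icc (k + 1) d)) :
    concat k' i' (rightPart k' (concat k i j)) = concat k (concat k' i' (rightPart k' i)) j := by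
  funext a
  by_cases h1 : (a : ℕ) ≤ k'
  · simp only [concat, rightPart, dif_pos h1, dif_pos (h1.trans hk')]
  · by_cases h2 : (a : ℕ) ≤ k
    · simp only [concat, rightPart, dif_neg h1, dif_pos h2]
    · simp only [concat, rightPart, dif_neg h1, dif_neg h2]

theorem concat_leftPart_concat {k' k : ℕ} (hk' : k' ≤ k) (hk : k ≤ d)
    (i : MultiIndex n (Finset.Icc 1 k')) (j : MultiIndex n (Finset.Icc (k' + 1) d))
    (j' : MultiIndex n (Finset.Icc (k + 1) d)) :
    concat k (leftPart k hk (concat k' i j)) j' =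
      concat k' i (rightPart k' (concat k (leftPart k hk (concat k' i j)) j')) := by
  conv_lhs => rw [← concat_leftPart_rightPart (hk'.trans hk)
    (concat k (leftPart k hk (concat k' i j)) j')]
  congr 1
  rw [leftPart_concat_of_le hk' hk]
  funext a
  simp only [concat, leftPart, dif_pos (Finset.mem_Icc.1 a.2).2]

theorem rightPart_concat_leftPart_congr {k' k : ℕ} (hk : k ≤ d)
    (i i' : MultiIndex n (Finset.Icc 1 k')) (j : MultiIndex n (Finset.Icc (k' + 1) d))
    (j' : MultiIndex n (Finset.Icc (k + 1) d)) :
    rightPart k' (concat k (leftPart k hk (concat k' i j)) j') =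
      rightPart k' (concat k (leftPart k hk (concat k' i' j)) j') := by
  funext a
  have h : ¬ (a : ℕ) ≤ k' := not_le.2 (Nat.lt_of_succ_le (Finset.mem_Icc.1 a.2).1)
  simp only [concat, rightPart, leftPart, dif_neg h]

/-- Splitting a multi-index after the first `k` components. -/
def concatEquiv (k : ℕ) (hk : k ≤ d) :
    MultiIndex n (Finset.Icc 1 k) × MultiIndex n (Finset.Icc (k + 1) d) ≃
      MultiIndex n (Finset.Icc 1 d) where
  toFun p := concat k p.1 p.2
  invFun l := (leftPart k hk l, rightPart k l)
  left_inv p := by simp [leftPart_concat, rightPart_concat]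
  right_inv l := concat_leftPart_rightPart hk l

theorem sum_concat (k : ℕ) (hk : k ≤ d) (f : MultiIndex n (Finset.Icc 1 d) → ℝ) :
    ∑ i, ∑ j, f (concat k i j) = ∑ l, f l := by
  rw [← (concatEquiv k hk).sum_comp, Fintype.sum_prod_type]
  rfl

theorem card_multiIndex (s : Finset ℕ) :
    Fintype.card (MultiIndex n s) = ∏ k ∈ s, n k := by
  rw [Fintype.card_pi, ← Finset.prod_coe_sort s]
  simp

/-- A column of the `k`-th unfolding. -/
def column (k : ℕ) (j : MultiIndex n (Finset.Icc (k + 1) d)) :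
    Tensor d n →ₗ[ℝ] EuclideanSpace ℝ (MultiIndex n (Finset.Icc 1 k)) where
  toFun x := WithLp.toLp 2 fun i => x (concat k i j)
  map_add' _ _ := rfl
  map_smul' _ _ := rfl

/-- A row of the `k`-th unfolding. -/
def row (k : ℕ) (i : MultiIndex n (Finset.Icc 1 k)) :
    Tensor d n →ₗ[ℝ] EuclideanSpace ℝ (MultiIndex n (Finset.Icc (k + 1) d)) where
  toFun x := WithLp.toLp 2 fun j => x (concat k i j)
  map_add' _ _ := rfl
  map_smul' _ _ := rfl

theorem column_apply (k : ℕ) (j : MultiIndex n (Finset.Icc (k + 1) d)) (x : Tensor d n)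
    (i : MultiIndex n (Finset.Icc 1 k)) : column k j x i = x (concat k i j) := rfl

theorem row_apply (k : ℕ) (i : MultiIndex n (Finset.Icc 1 k)) (x : Tensor d n)
    (j : MultiIndex n (Finset.Icc (k + 1) d)) : row k i x j = x (concat k i j) := rfl

/-- Tensors whose `k`-th unfolding has all its columns in `C`. -/
def columnsIn (k : ℕ) (C : Submodule ℝ (EuclideanSpace ℝ (MultiIndex n (Finset.Icc 1 k)))) :
    Submodule ℝ (Tensor d n) := ⨅ j, C.comap (column k j)

/-- Tensors whose `k`-th unfolding has all its rows in `D`. -/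
def rowsIn (k : ℕ) (D : Submodule ℝ (EuclideanSpace ℝ (MultiIndex n (Finset.Icc (k + 1) d)))) :
    Submodule ℝ (Tensor d n) := ⨅ i, D.comap (row k i)

theorem mem_columnsIn {k : ℕ} {C : Submodule ℝ (EuclideanSpace ℝ (MultiIndex n (Finset.Icc 1 k)))}
    {x : Tensor d n} : x ∈ columnsIn k C ↔ ∀ j, column k j x ∈ C := by
  simp [columnsIn]

theorem mem_rowsIn {k : ℕ}
    {D : Submodule ℝ (EuclideanSpace ℝ (MultiIndex n (Finset.Icc (k + 1) d)))}
    {x : Tensor d n} : x ∈ rowsIn k D ↔ ∀ i, row k i x ∈ D := by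
  simp [rowsIn]

theorem inner_eq_sum_column (k : ℕ) (hk : k ≤ d) (x y : Tensor d n) :
    inner ℝ x y = ∑ j, inner ℝ (column k j x) (column k j y) := by
  simp only [PiLp.inner_apply, column_apply]
  rw [Finset.sum_comm]
  exact (sum_concat k hk fun l => inner ℝ (x l) (y l)).symm

/-- The Frobenius inner product is the sum of the inner products of the columns, so this projection
acts on each column separately. -/
theorem column_starProjection_columnsIn {k : ℕ} (hk : k ≤ d)
    (C : Submodule ℝ (EuclideanSpace ℝ (MultiIndex n (Finset.Icc 1 k)))) (x : Tensor d n)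
    (j : MultiIndex n (Finset.Icc (k + 1) d)) :
    column k j ((columnsIn k C).starProjection x) = C.starProjection (column k j x) := by
  set y : Tensor d n := WithLp.toLp 2 fun l =>
    C.starProjection (column k (rightPart k l) x) (leftPart k hk l) with hy
  have hcol : ∀ j, column k j y = C.starProjection (column k j x) := fun j => by
    ext i
    simp only [column_apply, hy, rightPart_concat, leftPart_concat]
  rw [Submodule.eq_starProjection_of_mem_of_inner_eq_zero (v := y), hcol]
  · exact mem_columnsIn.2 fun j => hcol j ▸ C.starProjection_apply_mem _
  · intro z hz
    rw [inner_eq_sum_column k hk]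
    refine Finset.sum_eq_zero fun j _ => ?_
    rw [map_sub, hcol]
    exact Submodule.starProjection_inner_eq_zero _ _ (mem_columnsIn.1 hz j)

theorem toEuclideanLin_unfolding_eq_sum {k : ℕ} (x : Tensor d n)
    (w : EuclideanSpace ℝ (MultiIndex n (Finset.Icc (k + 1) d))) :
    Matrix.toEuclideanLin (unfolding x k) w = ∑ j, w j • column k j x := by
  ext i
  rw [Matrix.toLpLin_apply]
  simp [Matrix.mulVec, dotProduct, unfolding, column_apply, mul_comm]

theorem inner_row_eq {k : ℕ} (x : Tensor d n)
    (w : EuclideanSpace ℝ (MultiIndex n (Finset.Icc (k + 1) d)))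
    (i : MultiIndex n (Finset.Icc 1 k)) :
    inner ℝ w (row k i x) = Matrix.toEuclideanLin (unfolding x k) w i := by
  rw [Matrix.toLpLin_apply, PiLp.inner_apply]
  simp [Matrix.mulVec, dotProduct, unfolding, row_apply]

/-- Rephrases a condition on rows as linear relations between columns, a form that survives
operators acting on the first modes. -/
theorem mem_rowsIn_iff_toEuclideanLin_eq_zero {k : ℕ}
    {D : Submodule ℝ (EuclideanSpace ℝ (MultiIndex n (Finset.Icc (k + 1) d)))} {x : Tensor d n} :
    x ∈ rowsIn k D ↔ ∀ w ∈ Dᗮ, Matrix.toEuclideanLin (unfolding x k) w = 0 := by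
  rw [mem_rowsIn]
  constructor
  · intro h w hw
    ext i
    rw [← inner_row_eq]
    exact Submodule.inner_left_of_mem_orthogonal (h i) hw
  · intro h i
    rw [← D.orthogonal_orthogonal, Submodule.mem_orthogonal]
    intro w hw
    rw [inner_row_eq, h w hw]
    rfl

theorem column_mem_columnSpace {k : ℕ} (A : Tensor d n)
    (j : MultiIndex n (Finset.Icc (k + 1) d)) : column k j A ∈ columnSpace (unfolding A k) := by
  refine ⟨EuclideanSpace.single j 1, ?_⟩
  rw [toEuclideanLin_unfolding_eq_sum]
  simp

/-- The projections onto `columnsIn k' C` and onto `rowsIn k D` act on different modes. -/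
theorem starProjection_columnsIn_mem_rowsIn {k' k : ℕ} (hk' : k' ≤ k) (hk : k ≤ d)
    (C : Submodule ℝ (EuclideanSpace ℝ (MultiIndex n (Finset.Icc 1 k'))))
    {D : Submodule ℝ (EuclideanSpace ℝ (MultiIndex n (Finset.Icc (k + 1) d)))} {y : Tensor d n}
    (hy : y ∈ rowsIn k D) : (columnsIn k' C).starProjection y ∈ rowsIn k D := by
  rw [mem_rowsIn_iff_toEuclideanLin_eq_zero] at hy ⊢
  intro w hw
  have hyw := hy w hw
  rw [toEuclideanLin_unfolding_eq_sum] at hyw ⊢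
  have h0 : ∀ i, ∑ j, w j * y (concat k i j) = 0 := fun i => by
    have := congrArg (fun v => v.ofLp i) hyw
    simpa [column_apply] using this
  ext i
  set z := (columnsIn k' C).starProjection y
  have hz : ∀ j, z (concat k i j) =
      C.starProjection (column k' (rightPart k' (concat k i j)) y) (leftPart k' hk' i) := by
    intro j
    rw [← column_starProjection_columnsIn (hk'.trans hk), column_apply,
      ← leftPart_concat_of_le hk' hk i j, concat_leftPart_rightPart]
  have hsum : ∑ j, w j • column k' (rightPart k' (concat k i j)) y = 0 := by
    ext i'
    simpa [column_apply, concat_rightPart_concat hk'] using h0 (concat k' i' (rightPart k' i))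
  have h1 := congrArg C.starProjection hsum
  rw [map_sum, map_zero] at h1
  have h2 := congrArg (fun v => v.ofLp (leftPart k' hk' i)) h1
  simpa [column_apply, hz] using h2

/-- Freezing the modes `k' + 1, …, k` in a column of the `k`-th unfolding of `A` leaves a column of
the `k'`-th one. Hence the same slices of any combination of the former lie in the column space of
the latter. -/
theorem columnsIn_columnSpace_le {k' k : ℕ} (hk' : k' ≤ k) (hk : k ≤ d) (A : Tensor d n) :
    columnsIn k (columnSpace (unfolding A k)) ≤
      (columnsIn k' (columnSpace (unfolding A k')) : Submodule ℝ (Tensor d n)) := by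
  intro x hx
  rw [mem_columnsIn] at hx ⊢
  intro j
  by_cases hne : Nonempty (MultiIndex n (Finset.Icc 1 k'))
  · obtain ⟨i₀⟩ := hne
    set l : MultiIndex n (Finset.Icc 1 k') → MultiIndex n (Finset.Icc 1 k) :=
      fun i => leftPart k hk (concat k' i j) with hl
    set s : MultiIndex n (Finset.Icc (k + 1) d) → MultiIndex n (Finset.Icc (k' + 1) d) :=
      fun j' => rightPart k' (concat k (l i₀) j') with hs
    set j₁ := rightPart k (concat k' i₀ j) with hj₁
    obtain ⟨v, hv⟩ := hx j₁
    rw [toEuclideanLin_unfolding_eq_sum] at hv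
    have : column k' j x = ∑ j', v j' • column k' (s j') A := by
      ext i
      have h1 : concat k' i j = concat k (l i) j₁ := by
        rw [← concat_leftPart_rightPart hk (concat k' i j)]
        congr 1
        funext a
        have h : ¬ (a : ℕ) ≤ k' :=
          not_le.2 (hk'.trans_lt (Nat.lt_of_succ_le (Finset.mem_Icc.1 a.2).1))
        simp only [hj₁, concat, rightPart, dif_neg h]
      have h2 := congrArg (fun u => u.ofLp (l i)) hv
      rw [column_apply, h1]
      simp only [column_apply] at h2
      rw [← h2]
      simp only [WithLp.ofLp_sum, WithLp.ofLp_smul, Finset.sum_apply, Pi.smul_apply, column_apply]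
      refine Finset.sum_congr rfl fun j' _ => ?_
      simp only [hs, hl]
      rw [rightPart_concat_leftPart_congr hk i₀ i, ← concat_leftPart_concat hk' hk]
    rw [this]
    exact Submodule.sum_mem _ fun j' _ => Submodule.smul_mem _ _ (column_mem_columnSpace A _)
  · have : column k' j x = 0 := by
      ext i
      exact absurd ⟨i⟩ hne
    rw [this]
    exact Submodule.zero_mem _

end TensorTrain

/-! ### The tangency condition and entry bounds from coherence. -/

namespace TensorTrain

variable {n : ℕ → ℕ} {d : ℕ}

/-- The `k`-th unfolding as a linear map into operators. -/
noncomputable def unfoldingOp (d : ℕ) (n : ℕ → ℕ) (k : ℕ) : Tensor d n →ₗ[ℝ]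
    (EuclideanSpace ℝ (MultiIndex n (Finset.Icc (k + 1) d)) →L[ℝ]
      EuclideanSpace ℝ (MultiIndex n (Finset.Icc 1 k))) where
  toFun x := LinearMap.toContinuousLinearMap (Matrix.toEuclideanLin (unfolding x k))
  map_add' x y := by
    rw [← map_add, ← map_add]
    rfl
  map_smul' c x := by
    rw [← map_smul, ← map_smul]
    rfl

theorem unfoldingOp_apply (k : ℕ) (x : Tensor d n)
    (w : EuclideanSpace ℝ (MultiIndex n (Finset.Icc (k + 1) d))) :
    unfoldingOp d n k x w = Matrix.toEuclideanLin (unfolding x k) w := rfl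

theorem finrank_columnSpace {ι κ : Type*} [Fintype ι] [DecidableEq ι] [Fintype κ] [DecidableEq κ]
    (M : Matrix ι κ ℝ) : Module.finrank ℝ (columnSpace M) = M.rank := by
  rw [columnSpace, Matrix.rank_eq_finrank_range_toLin M (EuclideanSpace.basisFun ι ℝ).toBasis
    (EuclideanSpace.basisFun κ ℝ).toBasis, Matrix.toEuclideanLin_eq_toLin_orthonormal]

theorem toEuclideanLin_eq_zero_of_mem_orthogonal {ι κ : Type*} [Fintype ι] [DecidableEq ι]
    [Fintype κ] [DecidableEq κ] (M : Matrix ι κ ℝ) {w : EuclideanSpace ℝ κ}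
    (hw : w ∈ (columnSpace M.transpose)ᗮ) : Matrix.toEuclideanLin M w = 0 := by
  ext i
  have h := Submodule.inner_left_of_mem_orthogonal
    (show Matrix.toEuclideanLin M.transpose (EuclideanSpace.single i 1) ∈ columnSpace M.transpose
      from ⟨_, rfl⟩) hw
  rw [Matrix.toLpLin_apply] at h ⊢
  simpa [PiLp.inner_apply, Matrix.mulVec, dotProduct] using h

/-- A tangent tensor maps, in each unfolding, the orthogonal complement of the row space of `A`
into the column space of `A`. -/
theorem toEuclideanLin_unfolding_mem_of_mem_tangentSpace {r : ℕ → ℕ} {A : Tensor d n} {k : ℕ}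
    (hk : k ∈ Finset.Icc 1 (d - 1)) {x : Tensor d n} (hx : x ∈ tangentSpace r A)
    {w : EuclideanSpace ℝ (MultiIndex n (Finset.Icc (k + 1) d))}
    (hw : w ∈ (columnSpace (unfolding A k).transpose)ᗮ) :
    Matrix.toEuclideanLin (unfolding x k) w ∈ columnSpace (unfolding A k) := by
  rw [← unfoldingOp_apply]
  induction hx using Submodule.span_induction with
  | mem Y hY =>
    obtain ⟨γ, -, hγ, h0, hder⟩ := hY
    rw [← (columnSpace (unfolding A k)).orthogonal_orthogonal, Submodule.mem_orthogonal]
    intro u hu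
    have hG : HasDerivAt (fun t => unfoldingOp d n k (γ t)) (unfoldingOp d n k Y) 0 :=
      (LinearMap.toContinuousLinearMap (unfoldingOp d n k)).hasFDerivAt.comp_hasDerivAt 0 hder
    refine hG.apply_apply_eq_zero_of_finrank_range_eq (fun t => ?_) (w := w) ?_
      (φ := innerSL ℝ u) fun v => ?_
    · have hr : ∀ t, Module.finrank ℝ (unfoldingOp d n k (γ t)).range = r k := fun t =>
        (finrank_columnSpace (unfolding (γ t) k)).trans (hγ t k hk)
      rw [hr, hr]
    · rw [h0]
      exact toEuclideanLin_eq_zero_of_mem_orthogonal _ hw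
    · rw [h0]
      exact Submodule.inner_left_of_mem_orthogonal
        (show unfoldingOp d n k A v ∈ columnSpace (unfolding A k) from ⟨v, rfl⟩) hu
  | zero => simp
  | add x y _ _ hx hy =>
    rw [map_add]
    exact Submodule.add_mem _ hx hy
  | smul c x _ hx =>
    rw [map_smul]
    exact Submodule.smul_mem _ _ hx

/-- For `w` orthogonal to the row space, the unfolding of `x` sends `w` into the column space, where
the projection is the identity; so the residual sends `w` to `0`. -/
theorem sub_starProjection_mem_rowsIn {k : ℕ} (hk : k ≤ d) {A x : Tensor d n}
    (hx : ∀ w ∈ (columnSpace (unfolding A k).transpose)ᗮ,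
      Matrix.toEuclideanLin (unfolding x k) w ∈ columnSpace (unfolding A k)) :
    x - (columnsIn k (columnSpace (unfolding A k))).starProjection x ∈
      rowsIn k (columnSpace (unfolding A k).transpose) := by
  rw [mem_rowsIn_iff_toEuclideanLin_eq_zero]
  intro w hw
  have h := Submodule.starProjection_eq_self_iff.2 (hx w hw)
  rw [toEuclideanLin_unfolding_eq_sum] at h ⊢
  simp only [map_sub, column_starProjection_columnsIn hk, smul_sub, Finset.sum_sub_distrib]
  rw [map_sum] at h
  simp only [map_smul] at h
  rw [h, sub_self]

/-- For `v` in `C`, the entry `v i` is the inner product of `v` with the projection of the basis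
vector, so Cauchy–Schwarz applies. -/
theorem sq_apply_le_of_mem {ι : Type*} [Fintype ι] [DecidableEq ι]
    {C : Submodule ℝ (EuclideanSpace ℝ ι)} {a : ℝ}
    (ha : ∀ i, ‖C.starProjection (EuclideanSpace.single i 1)‖ ^ 2 ≤ a)
    {v : EuclideanSpace ℝ ι} (hv : v ∈ C) (i : ι) : v i ^ 2 ≤ a * ∑ j, v j ^ 2 := by
  have h1 : v i = inner ℝ (C.starProjection (EuclideanSpace.single i 1)) v := by
    rw [Submodule.inner_starProjection_left_eq_right, Submodule.starProjection_eq_self_iff.2 hv,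
      EuclideanSpace.inner_single_left]
    simp
  have h2 : ‖v‖ ^ 2 = ∑ j, v j ^ 2 := by simp [EuclideanSpace.norm_sq_eq]
  rw [← h2]
  calc v i ^ 2 ≤ (‖C.starProjection (EuclideanSpace.single i 1)‖ * ‖v‖) ^ 2 := by
        rw [← sq_abs, h1]
        gcongr
        exact abs_real_inner_le_norm _ _
    _ ≤ a * ‖v‖ ^ 2 := by rw [mul_pow]; gcongr; exact ha i

theorem sq_apply_le_of_mem_columnsIn {k : ℕ} (hk : k ≤ d)
    {C : Submodule ℝ (EuclideanSpace ℝ (MultiIndex n (Finset.Icc 1 k)))} {a : ℝ}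
    (ha : ∀ v ∈ C, ∀ i, v i ^ 2 ≤ a * ∑ j, v j ^ 2) {z : Tensor d n}
    (hz : z ∈ columnsIn k C) (l : MultiIndex n (Finset.Icc 1 d)) :
    z l ^ 2 ≤ a * ∑ i, z (concat k i (rightPart k l)) ^ 2 := by
  have := ha _ (mem_columnsIn.1 hz (rightPart k l)) (leftPart k hk l)
  simpa only [column_apply, concat_leftPart_rightPart] using this

theorem sq_apply_le_of_mem_rowsIn {k : ℕ}
    {D : Submodule ℝ (EuclideanSpace ℝ (MultiIndex n (Finset.Icc (k + 1) d)))} {b : ℝ}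
    (hb : ∀ v ∈ D, ∀ i, v i ^ 2 ≤ b * ∑ j, v j ^ 2) {z : Tensor d n}
    (hz : z ∈ rowsIn k D) (i : MultiIndex n (Finset.Icc 1 k))
    (j : MultiIndex n (Finset.Icc (k + 1) d)) :
    z (concat k i j) ^ 2 ≤ b * ∑ j', z (concat k i j') ^ 2 :=
  hb _ (mem_rowsIn.1 hz i) j

theorem norm_sq_eq_sum_concat {k : ℕ} (hk : k ≤ d) (z : Tensor d n) :
    ‖z‖ ^ 2 = ∑ i, ∑ j, z (concat k i j) ^ 2 := by
  rw [sum_concat k hk fun l => z l ^ 2, EuclideanSpace.norm_sq_eq]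
  simp

theorem sq_apply_le_norm_sq_of_mem_columnsIn {k : ℕ} (hk : k ≤ d)
    {C : Submodule ℝ (EuclideanSpace ℝ (MultiIndex n (Finset.Icc 1 k)))} {a : ℝ} (ha0 : 0 ≤ a)
    (ha : ∀ v ∈ C, ∀ i, v i ^ 2 ≤ a * ∑ j, v j ^ 2) {z : Tensor d n}
    (hz : z ∈ columnsIn k C) (l : MultiIndex n (Finset.Icc 1 d)) :
    z l ^ 2 ≤ a * ‖z‖ ^ 2 := by
  refine (sq_apply_le_of_mem_columnsIn hk ha hz l).trans ?_
  rw [norm_sq_eq_sum_concat hk, Finset.sum_comm]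
  gcongr
  exact Finset.single_le_sum (f := fun j => ∑ i, z (concat k i j) ^ 2)
    (fun _ _ => Finset.sum_nonneg fun _ _ => sq_nonneg _) (Finset.mem_univ _)

theorem sq_apply_le_norm_sq_of_mem_rowsIn {k : ℕ} (hk : k ≤ d)
    {D : Submodule ℝ (EuclideanSpace ℝ (MultiIndex n (Finset.Icc (k + 1) d)))} {b : ℝ}
    (hb0 : 0 ≤ b) (hb : ∀ v ∈ D, ∀ i, v i ^ 2 ≤ b * ∑ j, v j ^ 2)
    {z : Tensor d n} (hz : z ∈ rowsIn k D) (l : MultiIndex n (Finset.Icc 1 d)) :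
    z l ^ 2 ≤ b * ‖z‖ ^ 2 := by
  have := sq_apply_le_of_mem_rowsIn hb hz (leftPart k hk l) (rightPart k l)
  rw [concat_leftPart_rightPart] at this
  refine this.trans ?_
  rw [norm_sq_eq_sum_concat hk]
  gcongr
  exact Finset.single_le_sum (f := fun i => ∑ j, z (concat k i j) ^ 2)
    (fun _ _ => Finset.sum_nonneg fun _ _ => sq_nonneg _) (Finset.mem_univ _)

/-- The column bound spreads one entry over the first `k'` modes, and the row bound spreads each
resulting entry over the modes after `k`. The modes in between stay fixed, so the entries reached
are distinct and their squares sum to at most `‖z‖ ^ 2`. -/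
theorem sq_apply_le_norm_sq_of_mem_columnsIn_of_mem_rowsIn {k' k : ℕ} (hk' : k' ≤ k) (hk : k ≤ d)
    {C : Submodule ℝ (EuclideanSpace ℝ (MultiIndex n (Finset.Icc 1 k')))} {a : ℝ} (ha0 : 0 ≤ a)
    (ha : ∀ v ∈ C, ∀ i, v i ^ 2 ≤ a * ∑ j, v j ^ 2)
    {D : Submodule ℝ (EuclideanSpace ℝ (MultiIndex n (Finset.Icc (k + 1) d)))} {b : ℝ}
    (hb0 : 0 ≤ b) (hb : ∀ v ∈ D, ∀ i, v i ^ 2 ≤ b * ∑ j, v j ^ 2)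
    {z : Tensor d n} (hzC : z ∈ columnsIn k' C) (hzD : z ∈ rowsIn k D)
    (l : MultiIndex n (Finset.Icc 1 d)) : z l ^ 2 ≤ a * b * ‖z‖ ^ 2 := by
  set i := leftPart k hk l
  set j := rightPart k l
  have hl : concat k i j = l := concat_leftPart_rightPart hk l
  set g : MultiIndex n (Finset.Icc 1 k') → MultiIndex n (Finset.Icc 1 k) :=
    fun i' => concat k' i' (rightPart k' i)
  have hinj : Function.Injective g := fun i₁ i₂ h => by
    rw [← leftPart_concat hk' i₁ (rightPart k' i), ← leftPart_concat hk' i₂ (rightPart k' i)]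
    exact congrArg (leftPart k' hk') h
  calc z l ^ 2 ≤ a * ∑ i', z (concat k' i' (rightPart k' l)) ^ 2 :=
        sq_apply_le_of_mem_columnsIn (hk'.trans hk) ha hzC l
    _ = a * ∑ i', z (concat k (g i') j) ^ 2 := by
        congr 1
        refine Finset.sum_congr rfl fun i' _ => ?_
        rw [← hl, concat_rightPart_concat hk']
    _ ≤ a * ∑ i', b * ∑ j', z (concat k (g i') j') ^ 2 := by
        gcongr
        exact sq_apply_le_of_mem_rowsIn hb hzD _ _
    _ = a * b * ∑ i' ∈ Finset.univ.image g, ∑ j', z (concat k i' j') ^ 2 := by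
        rw [← Finset.mul_sum, mul_assoc, Finset.sum_image fun _ _ _ _ h => hinj h]
    _ ≤ a * b * ‖z‖ ^ 2 := by
        rw [norm_sq_eq_sum_concat hk]
        gcongr
        exact Finset.subset_univ _

theorem coherence_nonneg {ι : Type*} [Fintype ι] [DecidableEq ι]
    (T : Submodule ℝ (EuclideanSpace ℝ ι)) : 0 ≤ coherence T :=
  mul_nonneg (by positivity) (Real.iSup_nonneg fun _ => sq_nonneg _)

theorem norm_sq_starProjection_single_le {ι : Type*} [Fintype ι] [DecidableEq ι]
    {T : Submodule ℝ (EuclideanSpace ℝ ι)} {μ : ℝ} (hμ : coherence T ≤ μ)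
    (hT : 0 < Module.finrank ℝ T) (i : ι) :
    ‖T.starProjection (EuclideanSpace.single i 1)‖ ^ 2 ≤
      μ * Module.finrank ℝ T / Fintype.card ι := by
  have hc : 0 < Fintype.card ι := Fintype.card_pos_iff.2 ⟨i⟩
  have hT' : (0 : ℝ) < Module.finrank ℝ T := by exact_mod_cast hT
  have hc' : (0 : ℝ) < Fintype.card ι := by exact_mod_cast hc
  have h1 : ‖T.starProjection (EuclideanSpace.single i 1)‖ ^ 2 ≤
      ⨆ i : ι, ‖T.starProjection (EuclideanSpace.single i 1)‖ ^ 2 :=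
    le_ciSup (f := fun i => ‖T.starProjection (EuclideanSpace.single i (1 : ℝ))‖ ^ 2)
      (Set.finite_range _).bddAbove i
  refine h1.trans ?_
  rw [coherence] at hμ
  rw [le_div_iff₀ hc']
  calc _ = (Fintype.card ι : ℝ) / Module.finrank ℝ T *
        (⨆ i : ι, ‖T.starProjection (EuclideanSpace.single i 1)‖ ^ 2) * Module.finrank ℝ T := by
        field_simp
    _ ≤ _ := by gcongr

end TensorTrain

/-! ### The entry bound on the tangent space. -/

namespace TensorTrain

variable {n : ℕ → ℕ} {d : ℕ}

theorem coherence_columnSpace_le_interfaceCoherence (A : Tensor d n) {k : ℕ}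
    (hk : k ∈ Finset.Icc 1 (d - 1)) :
    coherence (columnSpace (unfolding A k)) ≤ interfaceCoherence A ∧
      coherence (columnSpace (unfolding A k).transpose) ≤ interfaceCoherence A := by
  have h := le_ciSup (f := fun k : Finset.Icc 1 (d - 1) =>
    max (coherence (columnSpace (unfolding A k)))
      (coherence (columnSpace (unfolding A k).transpose))) (Set.finite_range _).bddAbove ⟨k, hk⟩
  exact ⟨(le_max_left _ _).trans h, (le_max_right _ _).trans h⟩

theorem sq_apply_le_of_mem_columnSpace {ι κ : Type*} [Fintype ι] [DecidableEq ι] [Fintype κ]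
    [DecidableEq κ] (M : Matrix ι κ ℝ) {μ : ℝ} (hμ : coherence (columnSpace M) ≤ μ) {ρ : ℕ}
    (hM : M.rank = ρ) (hρ : 1 ≤ ρ) :
    ∀ v ∈ columnSpace M, ∀ i, v i ^ 2 ≤ μ * ρ / Fintype.card ι * ∑ j, v j ^ 2 := by
  intro v hv i
  have hf : Module.finrank ℝ (columnSpace M) = ρ := (finrank_columnSpace M).trans hM
  refine sq_apply_le_of_mem (fun i => ?_) hv i
  rw [← hf]
  exact norm_sq_starProjection_single_le hμ (by omega) i

/-- The contribution of the mode `k + 1` to the constant `C_0`. -/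
noncomputable def modeConst (d : ℕ) (n r : ℕ → ℕ) (μ : ℝ) (k : ℕ) : ℝ :=
  (if k = 0 then 1 else μ * r k / ∏ i ∈ Finset.Icc 1 k, (n i : ℝ)) *
    (if k + 1 = d then 1 else μ * r (k + 1) / ∏ i ∈ Finset.Icc (k + 2) d, (n i : ℝ))

theorem numEntries_eq_mul {k : ℕ} (hk : k ≤ d) :
    numEntries d n = (∏ i ∈ Finset.Icc 1 k, (n i : ℝ)) * ∏ i ∈ Finset.Icc (k + 1) d, (n i : ℝ) := by
  rw [numEntries, ← Finset.prod_union]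
  · congr 1
    ext a
    simp only [Finset.mem_Icc, Finset.mem_union]
    omega
  · rw [Finset.disjoint_left]
    intro a
    simp only [Finset.mem_Icc]
    omega

theorem prod_Icc_eq_mul {k : ℕ} (hk : k ≤ d) :
    ∏ i ∈ Finset.Icc k d, (n i : ℝ) = n k * ∏ i ∈ Finset.Icc (k + 1) d, (n i : ℝ) := by
  rw [← Finset.prod_insert (f := fun i => (n i : ℝ)) (by simp)]
  congr 1
  ext a
  simp only [Finset.mem_Icc, Finset.mem_insert]
  omega

/-- The two products in `modeConst` omit exactly the size of mode `k + 1`, which therefore appears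
in the numerator over `numEntries`. The first and last modes carry one factor `μ`, the others two.
-/
theorem sum_modeConst (hd : 2 ≤ d) (hn : ∀ k ∈ Finset.Icc 1 d, 1 ≤ n k) (r : ℕ → ℕ) (μ : ℝ) :
    ∑ k ∈ Finset.range d, modeConst d n r μ k = coherenceConst d n r μ := by
  have hn' : ∀ k ∈ Finset.Icc 1 d, (n k : ℝ) ≠ 0 := fun k hk =>
    Nat.cast_ne_zero.2 (Nat.one_le_iff_ne_zero.1 (hn k hk))
  have hp1 : ∀ k ≤ d, ∏ i ∈ Finset.Icc 1 k, (n i : ℝ) ≠ 0 := fun k hk =>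
    Finset.prod_ne_zero_iff.2 fun i hi => hn' i (Finset.Icc_subset_Icc_right hk hi)
  have hp2 : ∀ k, ∏ i ∈ Finset.Icc (k + 1) d, (n i : ℝ) ≠ 0 := fun k =>
    Finset.prod_ne_zero_iff.2 fun i hi => hn' i (Finset.Icc_subset_Icc_left (by omega) hi)
  obtain ⟨e, rfl⟩ := Nat.exists_eq_add_of_le' hd
  have hfirst : modeConst (e + 2) n r μ 0 = μ / numEntries (e + 2) n * (n 1 * r 1) := by
    have h1 : n 1 ≠ (0 : ℝ) := hn' 1 (by simp)
    have h2 := hp2 1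
    rw [numEntries, prod_Icc_eq_mul (by omega)]
    simp only [modeConst, zero_add, if_true, one_mul, if_neg (show ¬ (1 = e + 2) by omega)]
    field_simp
  have hlast : modeConst (e + 2) n r μ (e + 1) =
      μ / numEntries (e + 2) n * (r (e + 1) * n (e + 2)) := by
    have h1 : n (e + 2) ≠ (0 : ℝ) := hn' _ (by simp)
    have h2 := hp1 (e + 1) (by omega)
    rw [numEntries_eq_mul (show e + 1 ≤ e + 2 by omega), Finset.Icc_self, Finset.prod_singleton]
    simp only [modeConst, if_neg (show ¬ (e + 1 = 0) by omega), if_true, mul_one]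
    field_simp
  have hmid : ∀ k ∈ Finset.range e, modeConst (e + 2) n r μ (k + 1) =
      μ / numEntries (e + 2) n * (μ * (r (k + 1) * n (k + 2) * r (k + 2))) := by
    intro k hk
    have hk' := Finset.mem_range.1 hk
    have h1 : n (k + 2) ≠ (0 : ℝ) := hn' _ (Finset.mem_Icc.2 ⟨by omega, by omega⟩)
    have h2 := hp1 (k + 1) (by omega)
    have h3 := hp2 (k + 2)
    rw [numEntries_eq_mul (show k + 1 ≤ e + 2 by omega),
      prod_Icc_eq_mul (show k + 1 + 1 ≤ e + 2 by omega)]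
    simp only [modeConst, if_neg (show ¬ (k + 1 = 0) by omega),
      if_neg (show ¬ (k + 1 + 1 = e + 2) by omega)]
    field_simp
  have hsum : ∑ k ∈ Finset.Icc 2 (e + 2 - 1), (r (k - 1) * n k * r k : ℝ) =
      ∑ k ∈ Finset.range e, (r (k + 1) * n (k + 2) * r (k + 2) : ℝ) := by
    rw [Finset.range_eq_Ico,
      Finset.sum_congr (f := fun k => (r (k + 1) * n (k + 2) * r (k + 2) : ℝ)) rfl
        (g := fun k => (r (k + 2 - 1) * n (k + 2) * r (k + 2) : ℝ)) (fun _ _ => rfl),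
      Finset.sum_Ico_add' (fun k => (r (k - 1) * n k * r k : ℝ))]
    rfl
  rw [Finset.sum_range_succ, Finset.sum_range_succ', hfirst, hlast, Finset.sum_congr rfl hmid,
    coherenceConst, hsum, show e + 2 - 1 = e + 1 by omega, ← Finset.mul_sum, ← Finset.mul_sum]
  ring

/-- The column filtration of the tensor space attached to `A`. -/
noncomputable def filtration (A : Tensor d n) (k : ℕ) : Submodule ℝ (Tensor d n) :=
  if k = 0 then ⊤ else if k < d then columnsIn k (columnSpace (unfolding A k)) else ⊥

theorem filtration_succ_le (A : Tensor d n) (k : ℕ) : filtration A (k + 1) ≤ filtration A k := by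
  unfold filtration
  by_cases h0 : k = 0
  · simp [h0]
  · by_cases h1 : k + 1 < d
    · rw [if_neg (by omega), if_pos h1, if_neg h0, if_pos (by omega)]
      exact columnsIn_columnSpace_le (by omega) h1.le A
    · rw [if_neg (by omega), if_neg h1]
      exact bot_le

variable {r : ℕ → ℕ} {A : Tensor d n} {μ₀ : ℝ}

theorem interfaceCoherence_nonneg (hd : 2 ≤ d) (A : Tensor d n) : 0 ≤ interfaceCoherence A :=
  (coherence_nonneg _).trans
    (coherence_columnSpace_le_interfaceCoherence A (k := 1) (Finset.mem_Icc.2 ⟨le_rfl, by omega⟩)).1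

theorem modeConst_nonneg (hμ₀ : 0 ≤ μ₀) (k : ℕ) : 0 ≤ modeConst d n r μ₀ k := by
  unfold modeConst
  refine mul_nonneg ?_ ?_ <;> split_ifs <;> positivity

/-- The piece lies in `filtration A k`, which constrains its first `k` modes. It is also the
projection, acting on those modes only, of the residual of `x` at level `k + 1`, whose rows lie in
the row space by tangency. At `k = 0` and `k + 1 = d` only one of the constraints is present. -/
theorem sq_apply_starProjection_sub_le (hd : 2 ≤ d) (hr : ∀ k ∈ Finset.Icc 1 (d - 1), 1 ≤ r k)
    (hA : A ∈ fixedRank d n r) (hμ : interfaceCoherence A ≤ μ₀) {x : Tensor d n}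
    (hx : x ∈ tangentSpace r A) {k : ℕ} (hk : k < d) (l : MultiIndex n (Finset.Icc 1 d)) :
    ((filtration A k).starProjection x - (filtration A (k + 1)).starProjection x) l ^ 2 ≤
      modeConst d n r μ₀ k *
        ‖(filtration A k).starProjection x - (filtration A (k + 1)).starProjection x‖ ^ 2 := by
  have hμ₀ : 0 ≤ μ₀ := (interfaceCoherence_nonneg hd A).trans hμ
  set z := (filtration A k).starProjection x - (filtration A (k + 1)).starProjection x with hz
  have hC : ∀ k ∈ Finset.Icc 1 (d - 1), ∀ v ∈ columnSpace (unfolding A k), ∀ i,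
      v i ^ 2 ≤ μ₀ * r k / (∏ i ∈ Finset.Icc 1 k, (n i : ℝ)) * ∑ j, v j ^ 2 := fun k hk => by
    have := sq_apply_le_of_mem_columnSpace (unfolding A k)
      ((coherence_columnSpace_le_interfaceCoherence A hk).1.trans hμ) (hA k hk) (hr k hk)
    simpa only [card_multiIndex, Nat.cast_prod] using this
  have hD : ∀ k ∈ Finset.Icc 1 (d - 1), ∀ v ∈ columnSpace (unfolding A k).transpose, ∀ i,
      v i ^ 2 ≤ μ₀ * r k / (∏ i ∈ Finset.Icc (k + 1) d, (n i : ℝ)) * ∑ j, v j ^ 2 :=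
      fun k hk => by
    have := sq_apply_le_of_mem_columnSpace (unfolding A k).transpose
      ((coherence_columnSpace_le_interfaceCoherence A hk).2.trans hμ)
      ((Matrix.rank_transpose _).trans (hA k hk)) (hr k hk)
    simpa only [card_multiIndex, Nat.cast_prod] using this
  have hzk : z ∈ filtration A k := Submodule.sub_mem _ (Submodule.starProjection_apply_mem _ _)
    (filtration_succ_le A k (Submodule.starProjection_apply_mem _ _))
  have hzC : k ≠ 0 → z ∈ columnsIn k (columnSpace (unfolding A k)) := fun h0 => by
    rwa [filtration, if_neg h0, if_pos hk] at hzk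
  have hzD : k + 1 < d → z ∈ rowsIn (k + 1) (columnSpace (unfolding A (k + 1)).transpose) := by
    intro h1
    -- By nestedness the projection at level `k` fixes the projection at level `k + 1`.
    have h2 : z = (filtration A k).starProjection
        (x - (filtration A (k + 1)).starProjection x) := by
      rw [map_sub, hz, Submodule.starProjection_eq_self_iff.2
        (filtration_succ_le A k (Submodule.starProjection_apply_mem _ _))]
    have h3 : x - (filtration A (k + 1)).starProjection x ∈
        rowsIn (k + 1) (columnSpace (unfolding A (k + 1)).transpose) := by
      rw [show filtration A (k + 1) = columnsIn (k + 1) (columnSpace (unfolding A (k + 1))) by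
        rw [filtration, if_neg (by omega), if_pos h1]]
      exact sub_starProjection_mem_rowsIn h1.le fun w hw =>
        toEuclideanLin_unfolding_mem_of_mem_tangentSpace
          (Finset.mem_Icc.2 ⟨by omega, by omega⟩) hx hw
    rw [h2]
    by_cases h0 : k = 0
    · rwa [Submodule.starProjection_eq_self_iff.2]
      rw [filtration, if_pos h0]
      exact Submodule.mem_top
    · rw [show filtration A k = columnsIn k (columnSpace (unfolding A k)) by
        rw [filtration, if_neg h0, if_pos hk]]
      exact starProjection_columnsIn_mem_rowsIn (by omega) h1.le _ h3
  by_cases h0 : k = 0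
  · have h1 : k + 1 < d := by omega
    rw [modeConst, if_pos h0, if_neg h1.ne, one_mul]
    exact sq_apply_le_norm_sq_of_mem_rowsIn h1.le (by positivity)
      (hD (k + 1) (Finset.mem_Icc.2 ⟨by omega, by omega⟩)) (hzD h1) l
  · by_cases h1 : k + 1 = d
    · rw [modeConst, if_neg h0, if_pos h1, mul_one]
      exact sq_apply_le_norm_sq_of_mem_columnsIn hk.le (by positivity)
        (hC k (Finset.mem_Icc.2 ⟨by omega, by omega⟩)) (hzC h0) l
    · have h2 : k + 1 < d := by omega
      rw [modeConst, if_neg h0, if_neg h1]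
      exact sq_apply_le_norm_sq_of_mem_columnsIn_of_mem_rowsIn (by omega) h2.le (by positivity)
        (hC k (Finset.mem_Icc.2 ⟨by omega, by omega⟩)) (by positivity)
        (hD (k + 1) (Finset.mem_Icc.2 ⟨by omega, by omega⟩)) (hzC h0) (hzD h2) l

/-- The coherence of the tangent space: the entries of a tangent tensor are bounded in terms of its
norm. -/
theorem sq_apply_le_of_mem_tangentSpace (hd : 2 ≤ d) (hn : ∀ k ∈ Finset.Icc 1 d, 1 ≤ n k)
    (hr : ∀ k ∈ Finset.Icc 1 (d - 1), 1 ≤ r k)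
    (hA : A ∈ fixedRank d n r) (hμ : interfaceCoherence A ≤ μ₀) {x : Tensor d n}
    (hx : x ∈ tangentSpace r A) (l : MultiIndex n (Finset.Icc 1 d)) :
    x l ^ 2 ≤ coherenceConst d n r μ₀ * ‖x‖ ^ 2 := by
  have hμ₀ : 0 ≤ μ₀ := (interfaceCoherence_nonneg hd A).trans hμ
  have h0 : filtration A 0 = ⊤ := if_pos rfl
  have hd' : filtration A d = ⊥ := by
    rw [filtration, if_neg (by omega), if_neg (lt_irrefl d)]
  set z := fun k => (filtration A k).starProjection x - (filtration A (k + 1)).starProjection x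
  have hsum : ∑ k ∈ Finset.range d, z k = x := Submodule.sum_starProjection_sub h0 hd' x
  have hnorm : ∑ k ∈ Finset.range d, ‖z k‖ ^ 2 = ‖x‖ ^ 2 :=
    Submodule.sum_norm_starProjection_sub_sq h0 hd' (fun k _ => filtration_succ_le A k) x
  have habs : |x l| ≤ ∑ k ∈ Finset.range d, √(modeConst d n r μ₀ k) * ‖z k‖ := by
    have : x l = ∑ k ∈ Finset.range d, z k l := by
      conv_lhs => rw [← hsum]
      simp
    rw [this]
    refine (Finset.abs_sum_le_sum_abs _ _).trans (Finset.sum_le_sum fun k hk => ?_)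
    refine abs_le_of_sq_le_sq ?_ (by positivity)
    rw [mul_pow, Real.sq_sqrt (modeConst_nonneg hμ₀ k)]
    exact sq_apply_starProjection_sub_le hd hr hA hμ hx (Finset.mem_range.1 hk) l
  calc x l ^ 2 = |x l| ^ 2 := (sq_abs _).symm
    _ ≤ (∑ k ∈ Finset.range d, √(modeConst d n r μ₀ k) * ‖z k‖) ^ 2 := by gcongr
    -- Cauchy–Schwarz; orthogonality of the pieces then turns the second factor into `‖x‖ ^ 2`.
    _ ≤ (∑ k ∈ Finset.range d, √(modeConst d n r μ₀ k) ^ 2) * ∑ k ∈ Finset.range d, ‖z k‖ ^ 2 :=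
        Finset.sum_mul_sq_le_sq_mul_sq _ _ _
    _ = _ := by
        rw [hnorm, Finset.sum_congr rfl fun k _ => Real.sq_sqrt (modeConst_nonneg hμ₀ k),
          sum_modeConst hd hn]

end TensorTrain

/-! ### Transfer of the Bernstein inequality from matrices to operators. -/

section OperatorBernstein

open scoped MatrixOrder

variable {ι : Type*} [Fintype ι] [DecidableEq ι]

theorem Matrix.isHermitian_toEuclideanCLM_symm
    {f : EuclideanSpace ℝ ι →L[ℝ] EuclideanSpace ℝ ι}
    (hf : ∀ x y, inner ℝ (f x) y = inner ℝ x (f y)) :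
    ((Matrix.toEuclideanCLM (𝕜 := ℝ)).symm f : Matrix ι ι ℝ).IsHermitian := by
  rw [← Matrix.isSymmetric_toEuclideanLin_iff, ← Matrix.coe_toEuclideanCLM_eq_toEuclideanLin,
    StarAlgEquiv.apply_symm_apply]
  exact hf

theorem Matrix.toEuclideanCLM_symm_le_smul_one
    {f : EuclideanSpace ℝ ι →L[ℝ] EuclideanSpace ℝ ι}
    (hf : ∀ x y, inner ℝ (f x) y = inner ℝ x (f y)) {b : ℝ}
    (hb : ∀ x, inner ℝ x (f x) ≤ b * ‖x‖ ^ 2) :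
    (Matrix.toEuclideanCLM (𝕜 := ℝ)).symm f ≤ b • (1 : Matrix ι ι ℝ) := by
  have hMh := Matrix.isHermitian_toEuclideanCLM_symm hf
  set M : Matrix ι ι ℝ := (Matrix.toEuclideanCLM (𝕜 := ℝ)).symm f with hM
  have hMf : Matrix.toEuclideanCLM (𝕜 := ℝ) M = f := StarAlgEquiv.apply_symm_apply _ _
  rw [Matrix.le_iff]
  refine Matrix.PosSemidef.of_dotProduct_mulVec_nonneg ?_ fun x => ?_
  · refine Matrix.IsHermitian.sub ?_ hMh
    rw [Matrix.IsHermitian, Matrix.conjTranspose_smul, Matrix.conjTranspose_one, star_trivial]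
  · have h := hb (WithLp.toLp 2 x)
    rw [← hMf, Matrix.inner_toEuclideanCLM, EuclideanSpace.norm_sq_eq] at h
    rw [Matrix.sub_mulVec, Matrix.smul_mulVec, Matrix.one_mulVec, star_trivial, dotProduct_sub,
      dotProduct_smul]
    simp only [Real.norm_eq_abs, sq_abs] at h
    have h2 : x ⬝ᵥ x = ∑ i, x i ^ 2 := by simp [dotProduct, pow_two]
    rw [h2, smul_eq_mul]
    linarith

variable {σ : Type*} [Fintype σ]

/-- The matrix Bernstein inequality in counting form, for self-adjoint operators. -/
theorem ContinuousLinearMap.card_norm_sum_ge_le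
    {X : σ → EuclideanSpace ℝ ι →L[ℝ] EuclideanSpace ℝ ι} (hX : ∀ i x y, inner ℝ (X i x) y = inner ℝ x (X i y))
    {K ε : ℝ} (hK : 0 < K) (hε : 0 < ε) (hε1 : ε < 1) (h0 : ∑ i, X i = 0)
    (hle : ∀ i x, inner ℝ x (X i x) ≤ K * ‖x‖ ^ 2)
    (hge : ∀ i x, -inner ℝ x (X i x) ≤ K * ‖x‖ ^ 2)
    {m : ℕ} (hm : 0 < m)
    (hv : ∀ x, ∑ i, ‖X i x‖ ^ 2 ≤ (Fintype.card σ * K / m : ℝ) * ‖x‖ ^ 2) :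
    (Nat.card {w : Fin m → σ // ε ≤ ‖∑ j, X (w j)‖} : ℝ) ≤
      2 * Fintype.card ι * (Fintype.card σ : ℝ) ^ m * Real.exp (-(3 * ε ^ 2 / (8 * K))) := by
  set Φ := (Matrix.toEuclideanCLM (n := ι) (𝕜 := ℝ)).symm with hΦ
  have hΦX : ∀ f, Matrix.toEuclideanCLM (𝕜 := ℝ) (Φ f) = f :=
    fun f => StarAlgEquiv.apply_symm_apply _ _
  have hmain := Matrix.card_norm_sum_ge_le (X := fun i => Φ (X i)) (ε := ε) (m := m) (K := K)
    (fun i => Matrix.isHermitian_toEuclideanCLM_symm (hX i)) hK hε hε1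
    (by rw [← map_sum, h0, map_zero])
    (fun i => Matrix.toEuclideanCLM_symm_le_smul_one (hX i) (hle i))
    (fun i => by
      rw [← map_neg]
      refine Matrix.toEuclideanCLM_symm_le_smul_one (fun x y => ?_) fun x => ?_
      · simpa using hX i x y
      · simpa using hge i x) hm (by
      have h1 : ∑ i, Φ (X i) * Φ (X i) = Φ (∑ i, X i * X i) := by
        rw [map_sum]
        exact Finset.sum_congr rfl fun i _ => (map_mul Φ _ _).symm
      have h2 : ∀ i x y, inner ℝ (X i x) y = inner ℝ x (X i y) := fun i x y => hX i x y
      rw [h1]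
      refine Matrix.toEuclideanCLM_symm_le_smul_one (fun x y => ?_) fun x => ?_
      · simp only [sum_apply, inner_sum, sum_inner,
          mul_apply_eq_comp, h2]
      · refine le_trans (le_of_eq ?_) (hv x)
        simp only [sum_apply, inner_sum, mul_apply_eq_comp]
        exact Finset.sum_congr rfl fun i _ => by rw [← h2, real_inner_self_eq_norm_sq])
  simpa only [← map_sum, hΦX] using hmain

end OperatorBernstein

/-! ### From counting sample sequences to probabilities. -/

section UniformSamples

open MeasureTheory ProbabilityTheory

theorem measureReal_le_of_iIndepFun_uniform {σ : Type*} [Fintype σ] [Nonempty σ]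
    [MeasurableSpace σ] [MeasurableSingletonClass σ] {S : Type*} [MeasurableSpace S]
    (P : Measure S) [IsProbabilityMeasure P] {m : ℕ} {Ω : Fin m → S → σ}
    (hmeas : ∀ j, Measurable (Ω j)) (hindep : iIndepFun Ω P)
    (hunif : ∀ j, P.map (Ω j) = uniformOn Set.univ) (B : Set (Fin m → σ)) :
    P.real {s | (fun j => Ω j s) ∈ B} ≤ Nat.card B / (Fintype.card σ : ℝ) ^ m := by
  classical
  have h1 : ∀ w : Fin m → σ, P.real {s | (fun j => Ω j s) = w} =
      ((Fintype.card σ : ℝ) ^ m)⁻¹ := fun w => by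
    have h2 : {s | (fun j => Ω j s) = w} = ⋂ j ∈ Finset.univ, Ω j ⁻¹' {w j} := by
      ext s
      simp [funext_iff]
    have h3 : ∀ j, P (Ω j ⁻¹' {w j}) = (Fintype.card σ : ENNReal)⁻¹ := fun j => by
      rw [← Measure.map_apply (hmeas j) (measurableSet_singleton _), hunif, uniformOn_univ,
        Measure.count_singleton, one_div]
    rw [measureReal_def, h2, hindep.measure_inter_preimage_eq_mul Finset.univ
      (fun j _ => measurableSet_singleton (w j)), Finset.prod_congr rfl fun j _ => h3 j]
    simp
  have h4 : {s | (fun j => Ω j s) ∈ B} = ⋃ w ∈ B.toFinset, {s | (fun j => Ω j s) = w} := by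
    ext s
    simp
  rw [h4]
  refine (measureReal_biUnion_finset_le _ _).trans (le_of_eq ?_)
  rw [Finset.sum_congr rfl fun w _ => h1 w, Finset.sum_const, nsmul_eq_mul, Set.toFinset_card,
    Nat.card_eq_fintype_card, div_eq_mul_inv]

end UniformSamples

/-! ### Bernstein's inequality for sampling on a subspace with bounded entries. -/

section IncoherentSubspace

variable {ι : Type*} [Fintype ι]

theorem inner_self_starProjection (T : Submodule ℝ (EuclideanSpace ℝ ι)) (x : EuclideanSpace ℝ ι) :
    inner ℝ x (T.starProjection x) = ‖T.starProjection x‖ ^ 2 := by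
  rw [← real_inner_self_eq_norm_sq, Submodule.inner_starProjection_left_eq_right,
    Submodule.starProjection_eq_self_iff.2 (T.starProjection_apply_mem x)]

/-- Sum the entry bound over all `l` for one nonzero vector. This lets `C * N / m` dominate `1 / m`
in the Bernstein bounds. -/
theorem one_le_mul_card_of_sq_apply_le {T : Submodule ℝ (EuclideanSpace ℝ ι)} {C : ℝ} (hT : T ≠ ⊥)
    (hC : ∀ x ∈ T, ∀ l, x l ^ 2 ≤ C * ‖x‖ ^ 2) : 1 ≤ C * Fintype.card ι := by
  obtain ⟨x, hx, hx0⟩ := Submodule.exists_mem_ne_zero_of_ne_bot hT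
  have hpos : 0 < ‖x‖ ^ 2 := by positivity
  have h1 : ‖x‖ ^ 2 ≤ Fintype.card ι * (C * ‖x‖ ^ 2) := by
    have h2 : ‖x‖ ^ 2 = ∑ l, x l ^ 2 := by simp [EuclideanSpace.norm_sq_eq]
    rw [← nsmul_eq_mul, ← Finset.card_univ, ← Finset.sum_const]
    conv_lhs => rw [h2]
    exact Finset.sum_le_sum fun l _ => hC x hx l
  refine le_of_mul_le_mul_right ?_ hpos
  linarith

variable [DecidableEq ι]

/-- The centred contribution of one sampled index to the restriction of the sampling operator
to `T`. -/
noncomputable def sampleDeviation (T : Submodule ℝ (EuclideanSpace ℝ ι)) (m : ℕ) (a : ι) :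
    EuclideanSpace ℝ ι →L[ℝ] EuclideanSpace ℝ ι :=
  (m : ℝ)⁻¹ • (T.starProjection - (Fintype.card ι : ℝ) •
    ((EuclideanSpace.proj a ∘L T.starProjection : EuclideanSpace ℝ ι →L[ℝ] ℝ).smulRight
      (T.starProjection (EuclideanSpace.single a (1 : ℝ)))))

variable (T : Submodule ℝ (EuclideanSpace ℝ ι)) (m : ℕ)

theorem sampleDeviation_apply (a : ι) (x : EuclideanSpace ℝ ι) :
    sampleDeviation T m a x = (m : ℝ)⁻¹ • (T.starProjection x - ((Fintype.card ι : ℝ) *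
      T.starProjection x a) • T.starProjection (EuclideanSpace.single a (1 : ℝ))) := by
  simp [sampleDeviation, smul_smul]

theorem inner_starProjection_single (x : EuclideanSpace ℝ ι) (a : ι) :
    inner ℝ x (T.starProjection (EuclideanSpace.single a (1 : ℝ))) = T.starProjection x a := by
  rw [← Submodule.inner_starProjection_left_eq_right, EuclideanSpace.inner_single_right]
  simp

theorem inner_sampleDeviation (a : ι) (x y : EuclideanSpace ℝ ι) :
    inner ℝ x (sampleDeviation T m a y) = (m : ℝ)⁻¹ * (inner ℝ x (T.starProjection y) -
      Fintype.card ι * T.starProjection y a * T.starProjection x a) := by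
  rw [sampleDeviation_apply, inner_smul_right, inner_sub_right, inner_smul_right,
    inner_starProjection_single]

theorem sum_sampleDeviation : ∑ a, sampleDeviation T m a = 0 := by
  ext1 x
  have h1 : ∑ a, T.starProjection x a • EuclideanSpace.single a (1 : ℝ) = T.starProjection x := by
    ext i
    simp [Pi.single_apply]
  have h2 := congrArg T.starProjection h1
  rw [map_sum, Submodule.starProjection_eq_self_iff.2 (T.starProjection_apply_mem x)] at h2
  simp only [map_smul] at h2
  simp only [sum_apply, sampleDeviation_apply, mul_smul, ← Finset.smul_sum,
    Finset.sum_sub_distrib, h2, Finset.sum_const, Finset.card_univ, ← Nat.cast_smul_eq_nsmul ℝ,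
    sub_self, smul_zero, zero_apply]

variable {T m}

/-- The projected basis vector `y` satisfies `y a = ‖y‖ ^ 2`, so the entry bound at `a` reads `‖y‖ ^
4 ≤ C * ‖y‖ ^ 2`. -/
theorem norm_sq_starProjection_single_le_of_sq_apply_le {C : ℝ} (hC0 : 0 ≤ C)
    (hC : ∀ x ∈ T, ∀ l, x l ^ 2 ≤ C * ‖x‖ ^ 2) (a : ι) :
    ‖T.starProjection (EuclideanSpace.single a (1 : ℝ))‖ ^ 2 ≤ C := by
  set y := T.starProjection (EuclideanSpace.single a (1 : ℝ)) with hy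
  have h1 : y a = ‖y‖ ^ 2 := by
    rw [hy, ← inner_self_starProjection, EuclideanSpace.inner_single_left]
    simp
  have h2 := hC y (T.starProjection_apply_mem _) a
  rw [h1] at h2
  by_contra! hlt
  nlinarith [sq_nonneg ‖y‖]

/-- Bernstein with `K = C * N / m`. The positive part of a deviation is at most `1 / m ≤ K` and the
negative part at most `N * C / m = K`. Expanding the square and summing over `a` gives variance at
most `N ^ 2 * C / m ^ 2 = N * K / m`. -/
theorem card_norm_sum_sampleDeviation_ge_le {C : ℝ} (hT : T ≠ ⊥)
    (hC : ∀ x ∈ T, ∀ l, x l ^ 2 ≤ C * ‖x‖ ^ 2) (hm : 0 < m) {ε : ℝ} (hε : 0 < ε) (hε1 : ε < 1) :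
    (Nat.card {w : Fin m → ι // ε ≤ ‖∑ j, sampleDeviation T m (w j)‖} : ℝ) ≤
      2 * Fintype.card ι * (Fintype.card ι : ℝ) ^ m *
        Real.exp (-(3 * ε ^ 2 / (8 * (C * Fintype.card ι / m)))) := by
  have hCN := one_le_mul_card_of_sq_apply_le hT hC
  have hm' : (0 : ℝ) < m := by exact_mod_cast hm
  set N : ℝ := (Fintype.card ι : ℝ) with hN
  have hN0 : 0 ≤ N := by positivity
  have hC0 : 0 < C := by
    by_contra! h
    nlinarith
  have hPx' := T.norm_starProjection_apply_le
  have hPx : ∀ x : EuclideanSpace ℝ ι, ‖T.starProjection x‖ ^ 2 ≤ ‖x‖ ^ 2 := fun x => by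
    gcongr
    exact hPx' x
  have hK : 0 < C * N / m := div_pos (by linarith) hm'
  have hKm : (m : ℝ)⁻¹ ≤ C * N / m := by
    rw [← one_div]
    gcongr
  refine ContinuousLinearMap.card_norm_sum_ge_le (fun a x y => ?_) hK hε hε1
    (sum_sampleDeviation T m) (fun a x => ?_) (fun a x => ?_) hm fun x => ?_
  · rw [real_inner_comm, inner_sampleDeviation, inner_sampleDeviation,
      ← Submodule.inner_starProjection_left_eq_right T x y, real_inner_comm y]
    ring
  · rw [inner_sampleDeviation, inner_self_starProjection]
    calc _ ≤ (m : ℝ)⁻¹ * ‖x‖ ^ 2 := by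
          gcongr
          have := mul_nonneg hN0 (mul_self_nonneg (T.starProjection x a))
          linarith [hPx x]
      _ ≤ _ := by gcongr
  · rw [inner_sampleDeviation, inner_self_starProjection]
    have h1 : T.starProjection x a ^ 2 ≤ C * ‖x‖ ^ 2 :=
      (hC _ (T.starProjection_apply_mem x) a).trans (by gcongr; exact hPx' x)
    calc _ = (m : ℝ)⁻¹ * (N * T.starProjection x a ^ 2 - ‖T.starProjection x‖ ^ 2) := by ring
      _ ≤ (m : ℝ)⁻¹ * (N * (C * ‖x‖ ^ 2)) := by
          gcongr
          have := mul_le_mul_of_nonneg_left h1 hN0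
          linarith [sq_nonneg ‖T.starProjection x‖]
      _ = _ := by field_simp
  · have h1 : ∀ a, ‖sampleDeviation T m a x‖ ^ 2 ≤ ((m : ℝ)⁻¹) ^ 2 *
        (‖T.starProjection x‖ ^ 2 + (N ^ 2 * C - 2 * N) * T.starProjection x a ^ 2) := fun a => by
      rw [sampleDeviation_apply, norm_smul, mul_pow, Real.norm_of_nonneg (by positivity),
        norm_sub_sq_real, norm_smul, mul_pow, inner_smul_right, inner_starProjection_single,
        Submodule.starProjection_eq_self_iff.2 (T.starProjection_apply_mem x), Real.norm_eq_abs,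
        sq_abs]
      refine mul_le_mul_of_nonneg_left ?_ (by positivity)
      have h2 := norm_sq_starProjection_single_le_of_sq_apply_le hC0.le hC a
      have h3 := mul_le_mul_of_nonneg_left h2 (sq_nonneg (N * T.starProjection x a))
      linarith
    have h2 : ∑ a, T.starProjection x a ^ 2 = ‖T.starProjection x‖ ^ 2 := by
      simp [EuclideanSpace.norm_sq_eq]
    refine (Finset.sum_le_sum fun a _ => h1 a).trans ?_
    rw [← Finset.mul_sum, Finset.sum_add_distrib, ← Finset.mul_sum, h2, Finset.sum_const,
      Finset.card_univ, nsmul_eq_mul, ← hN]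
    calc _ = ((m : ℝ)⁻¹) ^ 2 * ((N ^ 2 * C - N) * ‖T.starProjection x‖ ^ 2) := by ring
      _ ≤ ((m : ℝ)⁻¹) ^ 2 * (N ^ 2 * C * ‖x‖ ^ 2) := by
          gcongr
          · linarith
          · exact hPx' x
      _ = _ := by field_simp

end IncoherentSubspace

/-! ### Application to the sampling operator on the tangent space. -/

namespace TensorTrain

variable {n : ℕ → ℕ} {d m : ℕ}

theorem numEntries_eq_card : numEntries d n = Fintype.card (MultiIndex n (Finset.Icc 1 d)) := by
  rw [card_multiIndex, numEntries, Nat.cast_prod]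

theorem numEntries_le_maxSize_pow : numEntries d n ≤ (maxSize d n : ℝ) ^ d := by
  have h := Finset.prod_le_pow_card (Finset.Icc 1 d) n (maxSize d n) fun k hk =>
    Finset.le_sup (f := n) hk
  rw [Nat.card_Icc, Nat.add_sub_cancel] at h
  rw [numEntries]
  exact_mod_cast h

theorem tangentProj_sub_eq_sum_sampleDeviation (r : ℕ → ℕ) (A : Tensor d n) (hm : 0 < m)
    (w : Fin m → MultiIndex n (Finset.Icc 1 d)) :
    tangentProj r A - (density d n m)⁻¹ • (tangentProj r A ∘L samplingOp w ∘L tangentProj r A) =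
      ∑ j, sampleDeviation (tangentSpace r A) m (w j) := by
  have hm' : (m : ℝ) ≠ 0 := by exact_mod_cast hm.ne'
  ext1 x
  have hR : (∑ j, sampleDeviation (tangentSpace r A) m (w j)) x = tangentProj r A x -
      ((m : ℝ)⁻¹ * Fintype.card (MultiIndex n (Finset.Icc 1 d))) • ∑ j,
        tangentProj r A x (w j) • tangentProj r A (EuclideanSpace.single (w j) 1) := by
    simp only [sum_apply, sampleDeviation_apply, ← Finset.smul_sum, Finset.sum_sub_distrib,
      mul_smul, tangentProj]
    rw [smul_sub, Finset.sum_const, Finset.card_univ, Fintype.card_fin,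
      ← Nat.cast_smul_eq_nsmul ℝ, smul_smul, inv_mul_cancel₀ hm', one_smul]
  have hρ : (density d n m)⁻¹ =
      (m : ℝ)⁻¹ * Fintype.card (MultiIndex n (Finset.Icc 1 d)) := by
    rw [density, numEntries_eq_card, inv_div, div_eq_inv_mul]
  have hS : samplingOp w (tangentProj r A x) =
      ∑ j, tangentProj r A x (w j) • EuclideanSpace.single (w j) (1 : ℝ) := by
    simp only [samplingOp, sum_apply, ContinuousLinearMap.smulRight_apply]
    rfl
  rw [hR, hρ, sub_apply, smul_apply, ContinuousLinearMap.comp_apply,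
    ContinuousLinearMap.comp_apply, hS, map_sum]
  simp only [map_smul]

end TensorTrain

open MeasureTheory ProbabilityTheory TensorTrain in
theorem mainTheorem5 (d : ℕ) (hd : 2 ≤ d) (n : ℕ → ℕ) (hn : ∀ k ∈ Finset.Icc 1 d, 1 ≤ n k)
    (r : ℕ → ℕ) (hr : ∀ k ∈ Finset.Icc 1 (d - 1), 1 ≤ r k)
    (A : Tensor d n) (hA : A ∈ fixedRank d n r)
    (μ₀ : ℝ) (hμ : interfaceCoherence A ≤ μ₀)
    {S : Type*} [MeasurableSpace S] (P : Measure S) [IsProbabilityMeasure P]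
    (m : ℕ) (Ω : Fin m → S → MultiIndex n (Finset.Icc 1 d))
    (hmeas : ∀ j, Measurable (Ω j)) (hindep : iIndepFun Ω P)
    (hunif : ∀ j, P.map (Ω j) = uniformOn Set.univ)
    (ε : ℝ) (hε : 0 < ε) (hε1 : ε < 1) (β : ℝ) (hβ : 1 < β)
    (hρ : 8 / 3 * (coherenceConst d n r μ₀ / ε ^ 2) * d * β * Real.log (maxSize d n)
      ≤ density d n m) :
    1 - 2 * (maxSize d n : ℝ) ^ ((d : ℝ) * (1 - β)) ≤
      P.real {s | ‖tangentProj r A - (density d n m)⁻¹ •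
        (tangentProj r A ∘L samplingOp (fun j => Ω j s) ∘L tangentProj r A)‖ < ε} := by
  set M := maxSize d n with hM
  have hM1 : 1 ≤ M := (hn 1 (Finset.mem_Icc.2 ⟨le_rfl, by omega⟩)).trans
    (Finset.le_sup (f := n) (Finset.mem_Icc.2 ⟨le_rfl, by omega⟩))
  have hMpos : (0 : ℝ) < M := by exact_mod_cast hM1
  -- On a zero tangent space the operator vanishes; the lower bound `1 ≤ C * N` requires a nonzero
  -- one.
  by_cases hT : tangentSpace r A = ⊥
  · have hP : tangentProj r A = 0 := by
      ext1 x
      have h : tangentProj r A x ∈ tangentSpace r A :=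
        (tangentSpace r A).starProjection_apply_mem x
      rw [hT, Submodule.mem_bot] at h
      exact h
    have hpos : (0 : ℝ) ≤ 2 * (M : ℝ) ^ ((d : ℝ) * (1 - β)) := by positivity
    have hz : ∀ w : Fin m → MultiIndex n (Finset.Icc 1 d), tangentProj r A - (density d n m)⁻¹ •
        (tangentProj r A ∘L samplingOp w ∘L tangentProj r A) = 0 := fun w => by
      ext1 x
      rw [sub_apply, smul_apply, ContinuousLinearMap.comp_apply, hP, zero_apply, zero_apply,
        smul_zero, sub_zero]
    have hset : {s | ‖tangentProj r A - (density d n m)⁻¹ •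
        (tangentProj r A ∘L samplingOp (fun j => Ω j s) ∘L tangentProj r A)‖ < ε} = Set.univ :=
      Set.eq_univ_of_forall fun s => by
        rw [Set.mem_ofPred_eq, hz, norm_zero]
        exact hε
    rw [hset, probReal_univ]
    linarith
  -- If all sizes are `1` the logarithm is `0` and `hρ` gives nothing, but the claimed probability
  -- bound is then `-1`.
  rcases hM1.eq_or_lt with hM1 | hM2
  · rw [← hM1, Nat.cast_one, Real.one_rpow]
    linarith [measureReal_nonneg (μ := P) (s := {s | ‖tangentProj r A - (density d n m)⁻¹ •
        (tangentProj r A ∘L samplingOp (fun j => Ω j s) ∘L tangentProj r A)‖ < ε})]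
  have hC := fun x hx l => sq_apply_le_of_mem_tangentSpace (x := x) hd hn hr hA hμ hx l
  set C := coherenceConst d n r μ₀
  have hCN := one_le_mul_card_of_sq_apply_le hT hC
  set N : ℝ := (Fintype.card (MultiIndex n (Finset.Icc 1 d)) : ℝ) with hN
  have hN0 : 0 ≤ N := by positivity
  have hC0 : 0 < C := by
    by_contra! h
    nlinarith
  have hNpos : 0 < N := by
    by_contra! h
    nlinarith
  have hlog : 0 < Real.log M := Real.log_pos (by exact_mod_cast hM2)
  have hd0 : (0 : ℝ) < d := by exact_mod_cast (by omega : 0 < d)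
  have hdens : density d n m = m / N := by rw [density, numEntries_eq_card]
  have hm : 0 < m := by
    rcases Nat.eq_zero_or_pos m with h | h
    · have : 0 < 8 / 3 * (C / ε ^ 2) * d * β * Real.log M := by positivity
      rw [hdens, h, Nat.cast_zero, zero_div] at hρ
      linarith
    · exact h
  have hm' : (0 : ℝ) < m := by exact_mod_cast hm
  have : Nonempty (MultiIndex n (Finset.Icc 1 d)) :=
    Fintype.card_pos_iff.1 (Nat.cast_pos.1 hNpos)
  simp only [tangentProj_sub_eq_sum_sampleDeviation r A hm]
  set B : Set (Fin m → MultiIndex n (Finset.Icc 1 d)) :=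
    {w | ε ≤ ‖∑ j, sampleDeviation (tangentSpace r A) m (w j)‖} with hB
  have hbad := measureReal_le_of_iIndepFun_uniform P hmeas hindep hunif B
  have hcard := card_norm_sum_sampleDeviation_ge_le hT hC hm hε hε1
  -- Since `C * N / m` is `C` divided by the density, this is the hypothesis `hρ` multiplied by `3
  -- ε² / (8 C)`.
  have hexp : Real.exp (-(3 * ε ^ 2 / (8 * (C * N / m)))) ≤ (M : ℝ) ^ (-((d : ℝ) * β)) := by
    rw [Real.rpow_def_of_pos hMpos]
    refine Real.exp_le_exp.2 ?_
    have h1 : d * β * Real.log M ≤ 3 * ε ^ 2 / (8 * (C * N / m)) := by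
      rw [hdens] at hρ
      have h2 := mul_le_mul_of_nonneg_left hρ (show 0 ≤ 3 * ε ^ 2 / (8 * C) by positivity)
      calc _ = 3 * ε ^ 2 / (8 * C) * (8 / 3 * (C / ε ^ 2) * d * β * Real.log M) := by field_simp
        _ ≤ _ := h2
        _ = _ := by field_simp
    linarith
  have hNM : N ≤ (M : ℝ) ^ (d : ℝ) := by
    rw [hN, ← numEntries_eq_card, Real.rpow_natCast]
    exact numEntries_le_maxSize_pow
  have hbad' : P.real {s | (fun j => Ω j s) ∈ B} ≤ 2 * (M : ℝ) ^ ((d : ℝ) * (1 - β)) := by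
    refine hbad.trans ?_
    rw [div_le_iff₀ (pow_pos hNpos m)]
    refine hcard.trans ?_
    calc _ ≤ 2 * (M : ℝ) ^ (d : ℝ) * N ^ m * (M : ℝ) ^ (-((d : ℝ) * β)) := by gcongr
      _ = _ := by
        rw [mul_one_sub, sub_eq_add_neg, Real.rpow_add hMpos]
        ring
  -- Subadditivity applied to the good and bad events avoids any measurability of these events.
  have hunion : (1 : ℝ) ≤ P.real {s | ‖∑ j, sampleDeviation (tangentSpace r A) m (Ω j s)‖ < ε} +
      P.real {s | (fun j => Ω j s) ∈ B} := by
    rw [← probReal_univ (μ := P)]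
    refine (measureReal_mono ?_).trans (measureReal_union_le _ _)
    intro s _
    exact (lt_or_ge ‖∑ j, sampleDeviation (tangentSpace r A) m (Ω j s)‖ ε).imp id id
  linarith
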